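/- **Setting.** Let $N_d\ge 1$, $\gamma=1.4$. For a state $U=(\rho,\rho u,\rho e)\in\mathbb R\times\mathbb R^{N_d}\times\mathbb R$ put $p=(\gamma-1)(\rho e-\rho|u|^2/2)$, $c=\sqrt{\gamma p/\rho}$, $\nu(U)=|u|+c$, $s(U)=\ln p-\gamma\ln\rho+s_0$ (with $s_0\in\mathbb R$ a constant), and let $F(U)\cdot a=\big(\rho\,u\cdot a,\ \rho (u\cdot a)u+p\,a,\ (u\cdot a)(\rho e+p)\big)$ be the Euler flux. The Lax–Friedrichs flux with dissipation coefficient $\mu$ is $\widehat F_\mu(U_L,U_R,n)=\frac12(F(U_L)+F(U_R))\cdot n-\frac{\mu}{2}(U_R-U_L)$. Let $\Omega_e=\Phi(\Omega_e^{\rm r})\subset\mathbb R^{N_d}$ be a (possibly curved) element of volume $V_e>0$, where $\Omega_e^{\rm r}$ is compact and $\Phi$ is a $C^1$ map that is injective with invertible Jacobian $\mathcal J$ on $\Omega_e^{\rm r}$. Its boundary consists of finitely many $C^1$-parametrized faces with compact parameter domains and outward surface Jacobian vectors $\mathcal J^\partial_k$ (so that the Gauss–Green formula holds). The local basis consists of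 $C^1$ functions $\varphi_1,\dots,\varphi_{N_p}$ of the reference coordinate whose span contains the constants. There are a volume quadrature rule with points $r_v\in\Omega_e^{\rm r}$ and weights $w_v>0$ ($v=1,\dots,N_q$) such that $\int_{\Omega_e^{\rm r}}|\mathcal J|\varphi_m\,dr=\sum_v|\mathcal J(r_v)|\varphi_m(r_v)w_v$ for all $m$, and surface rules on the faces with points $g_{k,q}$ and weights $w_{k,q}>0$, with $\mathcal J_k^\partial(g_{k,q})\ne0$, that integrate $\mathcal J^\partial_k$ exactly on each face. Choose $N_p$ of the points $r_v$ as nodes $y_1,\dots,y_{N_p}$ such that $[\varphi_m(y_j)]$ is nonsingular; let $\phi_v$ be the corresponding Lagrange basis function if $r_v$ is a node and $\phi_v=0$ otherwise. Put $\widehat n=\mathcal J^\partial_k/|\mathcal J^\partial_k|$, $\zeta_{k,q}=|\mathcal J^\partial_k(g_{k,q})|w_{k,q}/V_e$, and, for given numbers $\theta_{k,q}$, $$\theta_v=\frac{|\mathcal J(r_v)|w_v}{V_e}-\sum_{k,q}\theta_{k,q}\,\phi_v(r(g_{k,q})).$$ Let $U_e=\sum_m\widetilde U_m\varphi_m$ be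 the discrete solution on $\Omega_e$ at time $t$, with trace $U_e^+$ at the surface quadrature points, and let $U_e^-$ be an exterior trace that is continuous on each face; assume $\rho>0$ and $p>0$ for all values of $U_e$ on $\Omega_e$ and of $U_e^-$ on $\partial\Omega_e$. Let $U_e^{\Delta t}=\sum_m\widetilde U_m^{\Delta t}\varphi_m$ be obtained from $U_e$ by one forward-Euler step of size $\Delta t>0$ of the DG weak form, that is, for every $i$, $$\sum_v|\mathcal J(r_v)|w_v\Big[\varphi_i\,\frac{U_e^{\Delta t}-U_e}{\Delta t}-F(U_e)\cdot\nabla_x\varphi_i\Big](r_v)+\sum_{k,q}|\mathcal J_k^\partial(g_{k,q})|w_{k,q}\,\varphi_i(r(g_{k,q}))\,\widehat F_{\mu_{k,q}}\big(U_e^+,U_e^-,\widehat n\big)(g_{k,q})=0,$$ where $\mu_{k,q}\ge\max\{\nu(U_e^+(g_{k,q})),\nu(U_e^-(g_{k,q}))\}$, and let $\overline U_e^{\Delta t}=V_e^{-1}\int_{\Omega_e}U_e^{\Delta t}\,dx$. Let $$\lambda^*=\max\Big\{\sqrt{N_d},\sqrt{2+\gamma(\gamma-1)}\Big\}\ \max_{k,q}\nu\big(U_e^+(g_{k,q})\big).$$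 **Lemma.** Suppose that $\theta_v\ge0$ for all $v$ and $\theta_{k,q}>0$ for all $(k,q)$, and that $\lambda$ is a number with $\lambda\ge\mu_{k,q}$ for all $(k,q)$ (in particular $\lambda\ge\nu(U_e^\pm(g_{k,q}))$; the choice $\mu_{k,q}=\lambda$ is allowed), $\lambda\ge\lambda^*$, and $$\Delta t\,\lambda\le\frac12\min_{k,q}\frac{\theta_{k,q}}{\zeta_{k,q}}.$$ Then $\overline U_e^{\Delta t}$ has positive density and pressure, the minimum below exists, and $$s\big(\overline U_e^{\Delta t}\big)\ \ge\ \min\{s(U(y)) : y\in\Omega_e\cup\partial\Omega_e^-\},$$ that is, the minimum over all values of $U_e$ on $\Omega_e$ and of the exterior trace $U_e^-$ on $\partial\Omega_e$. -/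

import Mathlib

open MeasureTheory

noncomputable section

namespace EBDG

/-- Points and vectors of `ℝ^d`, with the Euclidean norm. -/
abbrev Space (d : ℕ) : Type := EuclideanSpace ℝ (Fin d)

/-! ### The compressible Euler equations with the ideal gas law -/

/-- Conserved variables `(ρ, ρ u, ρ e)` of the Euler equations in `d` space dimensions. -/
abbrev State (d : ℕ) : Type := ℝ × Space d × ℝ

/-- The ratio of specific heats, `γ = 1.4`. -/
def gasGamma : ℝ := 7 / 5

variable {d : ℕ}

def density (U : State d) : ℝ := U.1

def momentum (U : State d) : Space d := U.2.1

/-- Total energy per unit volume, `ρ e`. -/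
def energy (U : State d) : ℝ := U.2.2

def velocity (U : State d) : Space d := (density U)⁻¹ • momentum U

/-- Ideal gas law. -/
def pressure (U : State d) : ℝ :=
  (gasGamma - 1) * (energy U - density U * ‖velocity U‖ ^ 2 / 2)

def soundSpeed (U : State d) : ℝ := √(gasGamma * pressure U / density U)

/-- The maximum characteristic speed `ν(U) = |u| + c`. -/
def waveSpeed (U : State d) : ℝ := ‖velocity U‖ + soundSpeed U

/-- The states on which the physical entropy is defined. -/
def Admissible (U : State d) : Prop := 0 < density U ∧ 0 < pressure U

/-- The physical entropy, with reference value `s₀`. -/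
def entropy (s₀ : ℝ) (U : State d) : ℝ :=
  Real.log (pressure U) - gasGamma * Real.log (density U) + s₀

/-- The contraction `F(U) · a` of the Euler flux tensor with a vector `a`. -/
def flux (U : State d) (a : Space d) : State d :=
  (density U * inner ℝ (velocity U) a,
    (density U * inner ℝ (velocity U) a) • velocity U + pressure U • a,
    inner ℝ (velocity U) a * (energy U + pressure U))

/-- The Lax–Friedrichs flux with dissipation coefficient `μ`. -/
def laxFriedrichs (μ : ℝ) (UL UR : State d) (a : Space d) : State d :=
  (1 / 2 : ℝ) • (flux UL a + flux UR a) - (μ / 2) • (UR - UL)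

/-! ### Curved elements -/

/-- The generalized cross product of `n` vectors of `ℝ^(n+1)`: its inner product with `v` is the
determinant with rows `v, t 0, …, t (n-1)`. For `n = 2` it is the usual cross product, for `n = 1`
it is the vector rotated by a right angle, and for `n = 0` it is the unit vector of the line. -/
def generalizedCross {n : ℕ} (t : Fin n → Space (n + 1)) : Space (n + 1) :=
  WithLp.toLp 2 fun i =>
    Matrix.det (Matrix.of (Matrix.vecCons (Pi.single i (1 : ℝ)) fun j => (t j).ofLp))

/-- The vectorial surface Jacobian of a parametrized hypersurface `x : ℝ^n → ℝ^(n+1)`. -/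
def hypersurfaceJacobian {n : ℕ} (x : Space n → Space (n + 1)) (g : Space n) : Space (n + 1) :=
  generalizedCross fun j => fderiv ℝ x g (EuclideanSpace.single j 1)

def divergence (f : Space d → Space d) (x : Space d) : ℝ :=
  ∑ i, (fderiv ℝ f x (EuclideanSpace.single i 1)) i

/-- A curved element in space dimension `N_d = n + 1`: the image of a compact reference element
under a geometric mapping, with finitely many parametrized faces. -/
structure Element (n : ℕ) where
  /-- the reference element -/
  ref : Set (Space (n + 1))
  ref_compact : IsCompact ref
  /-- the geometric mapping `r ↦ x` -/
  map : Space (n + 1) → Space (n + 1)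
  map_contDiff : ContDiff ℝ 1 map
  map_injOn : Set.InjOn map ref
  map_det_ne_zero : ∀ r ∈ ref, (fderiv ℝ map r).det ≠ 0
  volume_pos : 0 < volume (map '' ref)
  /-- the number of faces -/
  numFaces : ℕ
  /-- the parameter domains of the faces of the reference element -/
  face : Fin numFaces → Set (Space n)
  face_compact : ∀ k, IsCompact (face k)
  /-- the parametrization `g ↦ r` of the `k`-th face of the reference element -/
  facePar : Fin numFaces → Space n → Space (n + 1)
  facePar_contDiff : ∀ k, ContDiff ℝ 1 (facePar k)
  frontier_eq : frontier ref = ⋃ k, facePar k '' face k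
  /-- the sign that turns the surface Jacobian outward -/
  orient : Fin numFaces → ℝ
  orient_eq : ∀ k, orient k = 1 ∨ orient k = -1
  /-- The oriented faces are the closed boundary surface of the element, with outward normal: this
  is what the Gauss–Green formula expresses. -/
  gauss_green : ∀ f : Space (n + 1) → Space (n + 1), ContDiff ℝ 1 f →
    ∫ x in map '' ref, divergence f x =
      ∑ k, ∫ g in face k, inner ℝ (f (map (facePar k g)))
        (orient k • hypersurfaceJacobian (fun g' => map (facePar k g')) g)

namespace Element

variable {n : ℕ} (E : Element n)

/-- The physical element. -/
def carrier : Set (Space (n + 1)) := E.map '' E.ref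

/-- The inverse of the geometric mapping, from the physical to the reference element. -/
def toRef : Space (n + 1) → Space (n + 1) := Function.invFunOn E.map E.ref

/-- The volume `V_e`. -/
def vol : ℝ := volume.real E.carrier

/-- The geometric Jacobian `|𝒥(r)|`. -/
def jac (r : Space (n + 1)) : ℝ := |(fderiv ℝ E.map r).det|

/-- The outward surface Jacobian `𝒥_k^∂(g)`. -/
def surfJac (k : Fin E.numFaces) (g : Space n) : Space (n + 1) :=
  E.orient k • hypersurfaceJacobian (fun g' => E.map (E.facePar k g')) g

/-- The gradient with respect to the physical coordinate `x` of a function `f` given in the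
reference coordinate `r`, at the point with reference coordinate `r`. -/
def physGrad (f : Space (n + 1) → ℝ) (r : Space (n + 1)) : Space (n + 1) :=
  WithLp.toLp 2 fun i =>
    fderiv ℝ f r ((fderiv ℝ E.map r).inverse (EuclideanSpace.single i 1))

end Element

/-! ### Discontinuous Galerkin elements -/

/-- A DG element: a curved element with local basis functions (in the reference coordinate) that
span the constants, a volume rule with positive weights that integrates the discrete space exactly,
face rules with positive weights that integrate the surface normal exactly, and interpolation nodes
chosen among the volume quadrature points. -/
structure DGElement (n : ℕ) extends Element n where
  /-- `N_p` -/
  numBasis : ℕ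
  basis : Fin numBasis → Space (n + 1) → ℝ
  basis_contDiff : ∀ m, ContDiff ℝ 1 (basis m)
  one_mem_span : ∃ c : Fin numBasis → ℝ, ∀ r, ∑ m, c m * basis m r = 1
  /-- `N_q` -/
  numVol : ℕ
  volPt : Fin numVol → Space (n + 1)
  volPt_mem : ∀ v, volPt v ∈ ref
  volWt : Fin numVol → ℝ
  volWt_pos : ∀ v, 0 < volWt v
  vol_exact : ∀ m, ∫ r in ref, toElement.jac r * basis m r =
    ∑ v, toElement.jac (volPt v) * basis m (volPt v) * volWt v
  /-- `N_{q,k}^∂` -/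
  numSurf : Fin numFaces → ℕ
  surfPt : ∀ k, Fin (numSurf k) → Space n
  surfPt_mem : ∀ k q, surfPt k q ∈ face k
  surfWt : ∀ k, Fin (numSurf k) → ℝ
  surfWt_pos : ∀ k q, 0 < surfWt k q
  surfJac_ne_zero : ∀ k q, toElement.surfJac k (surfPt k q) ≠ 0
  surf_exact : ∀ k, ∫ g in face k, toElement.surfJac k g =
    ∑ q, surfWt k q • toElement.surfJac k (surfPt k q)
  /-- the interpolation nodes `y_1, …, y_{N_p}`, as indices of volume quadrature points -/
  node : Fin numBasis → Fin numVol
  node_nonsingular : (Matrix.of fun m j => basis m (volPt (node j))).det ≠ 0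

namespace DGElement

variable {n : ℕ} (E : DGElement n)

/-- The discrete field `∑_m Ũ_m φ_m(r)` with coefficients `W`. -/
def eval (W : Fin E.numBasis → State (n + 1)) (r : Space (n + 1)) : State (n + 1) :=
  ∑ m, E.basis m r • W m

/-- The element average `V_e⁻¹ ∫_{Ω_e} U_e(x) dx`. -/
def average (W : Fin E.numBasis → State (n + 1)) : State (n + 1) :=
  E.vol⁻¹ • ∫ x in E.carrier, E.eval W (E.toRef x)

/-- The Lagrange basis of the interpolation nodes, `[ϕ_j] = [φ_m(y_j)]⁻¹ [φ_m]`. -/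
def lagrange (j : Fin E.numBasis) (r : Space (n + 1)) : ℝ :=
  ∑ m, (Matrix.of fun m' j' => E.basis m' (E.volPt (E.node j')))⁻¹ j m * E.basis m r

/-- The Lagrange basis indexed by all volume quadrature points: it vanishes at the indices that are
not chosen as interpolation nodes. -/
def volShape (v : Fin E.numVol) (r : Space (n + 1)) : ℝ :=
  ∑ j, if E.node j = v then E.lagrange j r else 0

/-- The reference coordinate `r(g_{k,q})` of a surface quadrature point. -/
def surfRef (k : Fin E.numFaces) (q : Fin (E.numSurf k)) : Space (n + 1) :=
  E.facePar k (E.surfPt k q)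

/-- The outward unit normal at a surface quadrature point. -/
def normal (k : Fin E.numFaces) (q : Fin (E.numSurf k)) : Space (n + 1) :=
  ‖E.surfJac k (E.surfPt k q)‖⁻¹ • E.surfJac k (E.surfPt k q)

/-- `ζ_{k,q} = |𝒥_k^∂(g_{k,q})| w_{k,q} / V_e`. -/
def zeta (k : Fin E.numFaces) (q : Fin (E.numSurf k)) : ℝ :=
  ‖E.surfJac k (E.surfPt k q)‖ * E.surfWt k q / E.vol

/-- The volume weights `θ_v` that belong to the surface weights `θ_{k,q}`. -/
def thetaVol (θ : ∀ k, Fin (E.numSurf k) → ℝ) (v : Fin E.numVol) : ℝ :=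
  E.jac (E.volPt v) * E.volWt v / E.vol - ∑ k, ∑ q, θ k q * E.volShape v (E.surfRef k q)

/-- The preselected dissipation coefficient `λ*`. -/
def lambdaStar (W : Fin E.numBasis → State (n + 1)) : ℝ :=
  max √((n + 1 : ℕ) : ℝ) √(2 + gasGamma * (gasGamma - 1)) *
    ⨆ j : (k : Fin E.numFaces) × Fin (E.numSurf k), waveSpeed (E.eval W (E.surfRef j.1 j.2))

/-- The states attained on `Ω_e` by the discrete field and on `∂Ω_e^-` by the exterior trace. -/
def localStates (W : Fin E.numBasis → State (n + 1))
    (Uext : Fin E.numFaces → Space n → State (n + 1)) : Set (State (n + 1)) :=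
  {S | ∃ r ∈ E.ref, S = E.eval W r} ∪ {S | ∃ k, ∃ g ∈ E.face k, S = Uext k g}

/-- One forward-Euler step, from coefficients `W` to coefficients `W'`, of the DG weak form
tested with every basis function, with the integrals evaluated by the quadrature rules and
Lax–Friedrichs fluxes with dissipation coefficient `μ k q` at the surface quadrature points. -/
def IsEulerStep (Δt : ℝ) (μ : ∀ k, Fin (E.numSurf k) → ℝ)
    (Uext : Fin E.numFaces → Space n → State (n + 1))
    (W W' : Fin E.numBasis → State (n + 1)) : Prop :=
  ∀ i : Fin E.numBasis,
    ∑ v, (E.jac (E.volPt v) * E.volWt v * E.basis i (E.volPt v)) •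
        (Δt⁻¹ • (E.eval W' (E.volPt v) - E.eval W (E.volPt v)))
      - ∑ v, (E.jac (E.volPt v) * E.volWt v) •
          flux (E.eval W (E.volPt v)) (E.physGrad (E.basis i) (E.volPt v))
      + ∑ k, ∑ q, (‖E.surfJac k (E.surfPt k q)‖ * E.surfWt k q * E.basis i (E.surfRef k q)) •
          laxFriedrichs (μ k q) (E.eval W (E.surfRef k q)) (Uext k (E.surfPt k q)) (E.normal k q)
      = 0

end DGElement

end EBDG

end

open EBDG

noncomputable section

namespace EBDG

/-! ### Polynomial inequalities -/

/-! States with entropy at least `s` form a convex set: the internal energy dominates `κ ρ^(7/5)`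
with `κ = 5/2 * exp (s - s₀)` (`convex_minEntropy`). It therefore suffices to write the new average
as a convex combination of members of this set, with `s` the local minimum, which exists by
compactness.

Testing the scheme with the constant function gives the evolution of the average, and interpolation
at the nodes splits the old average into volume and surface values. The Lax–Friedrichs terms are
then regrouped into pair states, each mixing an interior trace `P` and an exterior trace `Q`, and
one state `VB` built from all terms `lam • P - flux P a` over the closed boundary. The remaining
weights `θ - 2 Δt lam ζ` of the interior traces are nonnegative by the CFL condition
(`minEntropy_average`).

A regrouped state `V`, with velocity `z` and isentropic sound speed `C`, is tested against the
supporting hyperplane of the convex set at the velocity and density of `V` itself. This functional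
splits into one term per contributing trace (`supportFunctional_flux_term_nonneg`). The pressure
constants attached to the terms recombine to the required one: by opposite normals in a pair, and by
`∑ ζ a = 0` on the closed surface.

Each term is nonnegative by one-variable polynomial inequalities, provided that a trace more
rarefied than `V`, with density ratio `t ^ 5 < 1`, satisfies `C t ^ 3 ≤ lam - z · a` (in a pair,
with its own dissipation coefficient in place of `lam`). This bound on the velocity of `V` follows
from the mass and momentum balances (`speed_core`, `closed_surface_term_bound`), and it is here that
`lam ≥ 8/5 ν(P)` enters. -/

lemma six_mul_pow_five_le (x : ℝ) (hx : 0 ≤ x) : 6 * x ^ 5 ≤ 5 * x ^ 6 + 1 := by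
  have : 5 * x ^ 6 + 1 - 6 * x ^ 5 =
      (x - 1) ^ 2 * (5 * x ^ 4 + 4 * x ^ 3 + 3 * x ^ 2 + 2 * x + 1) := by ring
  have h2 : 0 ≤ (x - 1) ^ 2 * (5 * x ^ 4 + 4 * x ^ 3 + 3 * x ^ 2 + 2 * x + 1) := by positivity
  linarith

/-- Convexity of the isentropic energy, in terms of the fifth root of the density. -/
lemma isentropic_gap_nonneg (t : ℝ) (ht : 0 ≤ t) : 0 ≤ 25 * t ^ 7 - 35 * t ^ 5 + 10 := by
  have : 25 * t ^ 7 - 35 * t ^ 5 + 10 =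
      5 * (t - 1) ^ 2 * (5 * t ^ 5 + 10 * t ^ 4 + 8 * t ^ 3 + 6 * t ^ 2 + 4 * t + 2) := by ring
  rw [this]; positivity

/-- The termwise entropy inequality on the expansive side. -/
lemma expansive_term_nonneg {t c σ a : ℝ} (ht : 0 < t) (hct : t ≤ c) (hq : 1 ≤ c ^ 2 * t ^ 5)
    (hσ : c ≤ σ) :
    0 ≤ σ * (25 * (c ^ 2 * t ^ 5) - 35 * t ^ 5 + 10 + 7 * a ^ 2 * t ^ 5)
      + 10 * (c ^ 2 * t ^ 5 - 1) * a := by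
  have hc : 0 < c := ht.trans_le hct
  set q := c ^ 2 * t ^ 5 with hqdef
  have hq0 : 0 < q := by positivity
  have htq : t ^ 7 ≤ q := by
    have : t ^ 2 ≤ c ^ 2 := by gcongr
    calc t ^ 7 = t ^ 2 * t ^ 5 := by ring
      _ ≤ q := by rw [hqdef]; gcongr
  have hgap := isentropic_gap_nonneg t ht.le
  have hD : 0 ≤ 25 * q - 35 * t ^ 5 + 10 := by linarith
  -- the discriminant bound
  obtain ⟨s, hs0, hsq⟩ : ∃ s : ℝ, 0 ≤ s ∧ s ^ 7 = q :=
    ⟨q ^ ((1 : ℝ) / 7), by positivity, by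
      rw [← Real.rpow_natCast, ← Real.rpow_mul hq0.le]; norm_num⟩
  have hs1 : 1 ≤ s := by
    by_contra h
    have : s ^ 7 < 1 := pow_lt_one₀ hs0 (not_le.mp h) (by norm_num)
    linarith
  have hts : t ≤ s := by
    by_contra h
    have : s ^ 7 < t ^ 7 := by gcongr; exact not_le.mp h
    linarith
  have ht5 : t ^ 5 ≤ s ^ 5 := by gcongr
  -- With `q = s ^ 7` and `q * t ^ 5 ≤ s ^ 12`, the discriminant inequality reduces to this
  -- polynomial on `s ≥ 1`. It has a triple zero at `s = 1` and nonnegative coefficients in `s - 1`.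
  have hpoly : 0 ≤ 150 * s ^ 14 + 120 * s ^ 7 - 25 - 245 * s ^ 12 := by
    obtain ⟨k, rfl⟩ : ∃ k, s = 1 + k := ⟨s - 1, by ring⟩
    have hk : 0 ≤ k := by linarith
    have : 150 * (1 + k) ^ 14 + 120 * (1 + k) ^ 7 - 25 - 245 * (1 + k) ^ 12 =
      150 * k ^ 14 + 2100 * k ^ 13 + 13405 * k ^ 12 + 51660 * k ^ 11 + 133980 * k ^ 10
      + 246400 * k ^ 9 + 329175 * k ^ 8 + 320880 * k ^ 7 + 224910 * k ^ 6 + 108780 * k ^ 5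
      + 33075 * k ^ 4 + 4900 * k ^ 3 := by ring
    rw [this]; positivity
  have hdisc : 25 * (q - 1) ^ 2 ≤ 7 * q * (25 * q - 35 * t ^ 5 + 10) := by
    have h1 : q * t ^ 5 ≤ s ^ 12 := by
      calc q * t ^ 5 ≤ s ^ 7 * s ^ 5 := by rw [hsq]; gcongr
        _ = s ^ 12 := by ring
    have h2 : q ^ 2 = s ^ 14 := by rw [← hsq]; ring
    nlinarith
  -- The bracket is nonnegative, so `σ` may be lowered to `c`; what remains is a quadratic in `a`,
  -- handled by completing the square.
  have hmono : c * (25 * q - 35 * t ^ 5 + 10 + 7 * a ^ 2 * t ^ 5) ≤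
      σ * (25 * q - 35 * t ^ 5 + 10 + 7 * a ^ 2 * t ^ 5) := by
    apply mul_le_mul_of_nonneg_right hσ; positivity
  have hquad : 0 ≤ c * (25 * q - 35 * t ^ 5 + 10 + 7 * a ^ 2 * t ^ 5) + 10 * (q - 1) * a := by
    have hpos : 0 < 7 * c * t ^ 5 := by positivity
    have : 0 ≤ (7 * c * t ^ 5) *
        (c * (25 * q - 35 * t ^ 5 + 10 + 7 * a ^ 2 * t ^ 5) + 10 * (q - 1) * a) := by
      have e : (7 * c * t ^ 5) *
        (c * (25 * q - 35 * t ^ 5 + 10 + 7 * a ^ 2 * t ^ 5) + 10 * (q - 1) * a) =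
        (7 * c * t ^ 5 * a + 5 * (q - 1)) ^ 2 +
        (7 * (c ^ 2 * t ^ 5) * (25 * q - 35 * t ^ 5 + 10) - 25 * (q - 1) ^ 2) := by ring
      rw [e, ← hqdef]
      have := sq_nonneg (7 * c * t ^ 5 * a + 5 * (q - 1))
      linarith
    exact nonneg_of_mul_nonneg_right this hpos
  linarith

/-- The isentropic termwise entropy inequality on the compressive side. -/
lemma isentropic_compressive_term_nonneg {t a : ℝ} (ht : 0 < t) (ht1 : t ≤ 1) (ha : 0 ≤ a) :
    0 ≤ t ^ 3 * (25 * t ^ 7 - 35 * t ^ 5 + 10) + 7 * t ^ 8 * a ^ 2 - 35 * t ^ 5 * (1 - t ^ 2) * a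
      + 7 * t ^ 5 * a ^ 3 := by
  have tangent : ∀ b : ℝ, 0 ≤ b → 3 * b ^ 2 * a - 2 * b ^ 3 ≤ a ^ 3 := fun b hb => by
    have : 0 ≤ (a - b) ^ 2 * (a + 2 * b) := by positivity
    nlinarith
  -- it is enough to replace `a ^ 3` by a tangent
  suffices h : ∃ b : ℝ, 0 ≤ b ∧ 0 ≤ 25 * t ^ 7 - 35 * t ^ 5 + 10 + 7 * t ^ 5 * a ^ 2
      - 35 * t ^ 2 * (1 - t ^ 2) * a + 7 * t ^ 2 * (3 * b ^ 2 * a - 2 * b ^ 3) by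
    obtain ⟨b, hb, h⟩ := h
    have h1 := mul_le_mul_of_nonneg_left (tangent b hb) (show 0 ≤ 7 * t ^ 5 by positivity)
    have h2 := mul_nonneg (show 0 ≤ t ^ 3 by positivity) h
    nlinarith
  rcases le_total t (1 / 2) with h1 | h1
  -- Here `21 * b ^ 2 > 35`, so the coefficient of `a` is nonnegative.
  · refine ⟨13 / 10, by norm_num, ?_⟩
    have p2 : t ^ 2 ≤ 1 / 4 := by nlinarith
    have p5 : t ^ 5 ≤ 1 / 32 := by
      calc t ^ 5 ≤ (1 / 2) ^ 5 := by gcongr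
        _ = 1 / 32 := by norm_num
    have : 0 ≤ t ^ 2 * a := by positivity
    have : 0 ≤ t ^ 4 * a := by positivity
    have : 0 ≤ t ^ 5 * a ^ 2 := by positivity
    have : 0 ≤ t ^ 7 := by positivity
    nlinarith
  rcases le_total t (13 / 20) with h2 | h2
  · refine ⟨1, by norm_num, ?_⟩
    obtain ⟨s, hs⟩ : ∃ s, s = t ^ 2 := ⟨_, rfl⟩
    have hs1 : 1 / 4 ≤ s := by rw [hs]; nlinarith
    have hs2 : s ≤ 169 / 400 := by rw [hs]; nlinarith
    have p5 : t ^ 5 ≤ 117 / 1000 := by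
      calc t ^ 5 ≤ (13 / 20) ^ 5 := by gcongr
        _ ≤ 117 / 1000 := by norm_num
    have p5' : 1 / 32 ≤ t ^ 5 := by
      calc (1 / 32 : ℝ) = (1 / 2) ^ 5 := by norm_num
        _ ≤ t ^ 5 := by gcongr
    have e : 25 * t ^ 7 - 35 * t ^ 5 + 10 + 7 * t ^ 5 * a ^ 2 - 35 * t ^ 2 * (1 - t ^ 2) * a
        + 7 * t ^ 2 * (3 * 1 ^ 2 * a - 2 * 1 ^ 3) =
        10 - 14 * s - (35 - 25 * s) * t ^ 5 + 7 * t ^ 5 * a ^ 2 - (14 * s - 35 * s ^ 2) * a := by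
      rw [hs]; ring
    rw [e]
    have h3 : (35 - 25 * s) * t ^ 5 ≤ (35 - 25 * s) * (117 / 1000) := by
      apply mul_le_mul_of_nonneg_left p5; linarith
    -- The coefficient is concave in `s = t ^ 2` and is bounded by its tangent at `s = 1/4`; `h6` is
    -- then the discriminant condition.
    have h4 : (14 * s - 35 * s ^ 2) * a ≤ (35 / 16 - 7 / 2 * s) * a := by
      apply mul_le_mul_of_nonneg_right _ ha; nlinarith [sq_nonneg (s - 1 / 4)]
    have h5 : 7 / 32 * a ^ 2 ≤ 7 * t ^ 5 * a ^ 2 := by nlinarith [sq_nonneg a]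
    have h6 : (35 / 16 - 7 / 2 * s) ^ 2 ≤
        7 / 8 * (10 - 14 * s - (35 - 25 * s) * (117 / 1000)) := by nlinarith
    have h7 := sq_nonneg (7 / 16 * a - (35 / 16 - 7 / 2 * s))
    nlinarith
  -- At `t = 1` the quadratic part degenerates to a perfect square at leading order, with minimizer
  -- `a ≈ 5 (1 - t)`. The tangent point has to tend to zero there, and this choice agrees with the
  -- minimizer to first order.
  · refine ⟨5 * t ^ 2 * (1 - t), by apply mul_nonneg <;> [positivity; linarith], ?_⟩
    set P := 2 + 4 * t + 6 * t ^ 2 + 8 * t ^ 3 + 10 * t ^ 4 + 5 * t ^ 5 with hP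
    have hdisc : 7 * (5 * (1 + t) - 75 * t ^ 4 * (1 - t)) ^ 2 ≤
        4 * t * (5 * P - 1750 * t ^ 8 * (1 - t)) := by
      -- A certificate on `[13/20, 1]`: since `u + 20 * v = 7`, the difference can be made
      -- homogeneous of degree 10 in `u, v ≥ 0`, with nonnegative coefficients.
      obtain ⟨u, hu⟩ : ∃ u, u = 20 * t - 13 := ⟨_, rfl⟩
      obtain ⟨v, hv⟩ : ∃ v, v = 1 - t := ⟨_, rfl⟩
      have hu0 : 0 ≤ u := by linarith
      have hv0 : 0 ≤ v := by linarith
      have e : 4 * t * (5 * P - 1750 * t ^ 8 * (1 - t))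
          - 7 * (5 * (1 + t) - 75 * t ^ 4 * (1 - t)) ^ 2 =
          2590159487625/5764801 * v ^ 10 + 3795403856000/5764801 * u * v ^ 9
          + 1267140105500/5764801 * u ^ 2 * v ^ 8 + 28360081000/823543 * u ^ 3 * v ^ 7
          + 2511415800/823543 * u ^ 4 * v ^ 6 + 135861700/823543 * u ^ 5 * v ^ 5
          + 4776220/823543 * u ^ 6 * v ^ 4 + 851680/5764801 * u ^ 7 * v ^ 3
          + 17100/5764801 * u ^ 8 * v ^ 2 + 200/5764801 * u ^ 9 * v := by
        rw [hP, hu, hv]; ring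
      have : 0 ≤ 4 * t * (5 * P - 1750 * t ^ 8 * (1 - t))
          - 7 * (5 * (1 + t) - 75 * t ^ 4 * (1 - t)) ^ 2 := by rw [e]; positivity
      linarith
    have hpos : 0 < 28 * t ^ 5 := by positivity
    refine nonneg_of_mul_nonneg_right ?_ hpos
    have e : 28 * t ^ 5 * (25 * t ^ 7 - 35 * t ^ 5 + 10 + 7 * t ^ 5 * a ^ 2
        - 35 * t ^ 2 * (1 - t ^ 2) * a
        + 7 * t ^ 2 * (3 * (5 * t ^ 2 * (1 - t)) ^ 2 * a - 2 * (5 * t ^ 2 * (1 - t)) ^ 3)) =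
        (14 * t ^ 5 * a - 7 * t ^ 2 * (1 - t) * (5 * (1 + t) - 75 * t ^ 4 * (1 - t))) ^ 2
        + 7 * t ^ 4 * (1 - t) ^ 2 * (4 * t * (5 * P - 1750 * t ^ 8 * (1 - t))
          - 7 * (5 * (1 + t) - 75 * t ^ 4 * (1 - t)) ^ 2) := by
      rw [hP]; ring
    rw [e]
    have : 0 ≤ 4 * t * (5 * P - 1750 * t ^ 8 * (1 - t))
          - 7 * (5 * (1 + t) - 75 * t ^ 4 * (1 - t)) ^ 2 := by linarith
    positivity

/-- The termwise entropy inequality on the compressive side. -/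
lemma compressive_term_nonneg {t c τ a : ℝ} (ht : 0 < t) (hct : t ≤ c)
    (hq : c ^ 2 * t ^ 5 ≤ 1) (hσ : 0 ≤ τ + a) (hτ : t < 1 → t ^ 3 ≤ τ) :
    0 ≤ (τ + a) * (25 * (c ^ 2 * t ^ 5) - 35 * t ^ 5 + 10 + 7 * a ^ 2 * t ^ 5)
      + 10 * (c ^ 2 * t ^ 5 - 1) * a := by
  set q := c ^ 2 * t ^ 5 with hqdef
  have htq : t ^ 7 ≤ q := by
    have : t ^ 2 ≤ c ^ 2 := by gcongr
    calc t ^ 7 = t ^ 2 * t ^ 5 := by ring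
      _ ≤ q := by rw [hqdef]; gcongr
  have hgap := isentropic_gap_nonneg t ht.le
  have hD : 0 ≤ 25 * q - 35 * t ^ 5 + 10 := by linarith
  have hK : 0 ≤ 25 * q - 35 * t ^ 5 + 10 + 7 * a ^ 2 * t ^ 5 := by positivity
  rcases le_total a 0 with ha | ha
  · have h1 : 0 ≤ (q - 1) * a := mul_nonneg_of_nonpos_of_nonpos (by linarith) ha
    have h2 := mul_nonneg hσ hK
    linarith
  · rcases (show t ≤ 1 by
        by_contra h
        have : 1 < t ^ 7 := one_lt_pow₀ (not_le.mp h) (by norm_num)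
        linarith).lt_or_eq with h1 | h1
    · have hτ' := hτ h1
      have key := isentropic_compressive_term_nonneg ht h1.le ha
      have h2 : (t ^ 3 + a) * (25 * q - 35 * t ^ 5 + 10 + 7 * a ^ 2 * t ^ 5) ≤
          (τ + a) * (25 * q - 35 * t ^ 5 + 10 + 7 * a ^ 2 * t ^ 5) := by gcongr
      -- This product is the excess over the isentropic case `q = t ^ 7`, so only that case matters.
      have h3 : 0 ≤ (q - t ^ 7) * (25 * (t ^ 3 + a) + 10 * a) := by
        apply mul_nonneg (by linarith); positivity
      nlinarith
    · subst h1
      have : q = 1 := le_antisymm hq (by simpa using htq)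
      rw [this]
      have := mul_nonneg hσ hK
      rw [‹q = 1›] at this
      linarith

/-! ### Speed bounds for the averaged state -/

/-- When the other state is slow (`c ≤ 1`), it can carry mass at most `G = c ^ 5 * (N - c)`. The
lower bound obtained from `A ≤ σ` increases with `A ≥ N - G`; at `A = N - G`, the square `(N - G -
1) ^ 2` and `(2 - c) * G ≤ N - 1` finish the estimate, the slack being governed by `t = 1`. -/
lemma speed_core_small {N t σ c : ℝ} (hN : 2 ≤ N) (ht : 0 < t) (ht1 : t ≤ 1) (hσ : 0 ≤ σ)
    (hc : 0 < c) (hc1 : c ≤ 1) (hm : N - t ^ 5 * σ ≤ c ^ 5 * (N - c)) :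
    0 ≤ t ^ 5 * σ * (σ - t ^ 3) + 5 / 7 * t ^ 7
      + (N - t ^ 5 * σ) * (c - t ^ 3 - 5 / 7 * c ^ 2 / (N - c)) := by
  set A := t ^ 5 * σ with hA
  set G := c ^ 5 * (N - c) with hG
  have hNc : 0 < N - c := by linarith
  have hG0 : 0 ≤ G := by positivity
  have hAσ : A * A ≤ A * σ := by
    have : A ≤ σ := by
      rw [hA]; exact mul_le_of_le_one_left hσ (pow_le_one₀ ht.le ht1)
    have : 0 ≤ A := by positivity
    gcongr
  -- monotonicity in `t`
  have ht3 : 0 ≤ (N - 2) * (1 - t ^ 3) :=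
    mul_nonneg (by linarith) (by linarith [pow_le_one₀ (n := 3) ht.le ht1])
  have ht7 : 5 / 7 * (1 - t ^ 7) ≤ 2 * (1 - t ^ 3) := by
    have : 2 * (1 - t ^ 3) - 5 / 7 * (1 - t ^ 7) =
      (1 - t) * (9 / 7 * (1 + t + t ^ 2) - 5 / 7 * (t ^ 3 + t ^ 4 + t ^ 5 + t ^ 6)) := by ring
    have h3 : t ^ 3 ≤ 1 := pow_le_one₀ ht.le ht1
    have h4 : t ^ 4 ≤ t := by simpa using pow_le_pow_of_le_one ht.le ht1 (show 1 ≤ 4 by norm_num)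
    have h5 : t ^ 5 ≤ t ^ 2 := pow_le_pow_of_le_one ht.le ht1 (by norm_num)
    have h6 : t ^ 6 ≤ t ^ 3 := pow_le_pow_of_le_one ht.le ht1 (by norm_num)
    have h6' : t ^ 6 ≤ t ^ 2 := pow_le_pow_of_le_one ht.le ht1 (by norm_num)
    have h6'' : t ^ 6 ≤ t := by simpa using pow_le_pow_of_le_one ht.le ht1 (show 1 ≤ 6 by norm_num)
    have : 0 ≤ (1 - t) * (9 / 7 * (1 + t + t ^ 2) - 5 / 7 * (t ^ 3 + t ^ 4 + t ^ 5 + t ^ 6)) := by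
      apply mul_nonneg <;> linarith
    linarith
  -- the lower bound for the mass of the first state
  have hc7 : c ^ 7 ≤ 1 := pow_le_one₀ hc.le hc1
  have hc3 : c ^ 3 ≤ 1 := pow_le_one₀ hc.le hc1
  have hcc : c * (2 - c) ≤ 1 := by nlinarith [sq_nonneg (c - 1)]
  have hcc0 : 0 ≤ c * (2 - c) := by apply mul_nonneg <;> linarith
  have hc5 : c ^ 5 * (2 - c) ≤ 1 := by
    calc c ^ 5 * (2 - c) = c ^ 4 * (c * (2 - c)) := by ring
      _ ≤ 1 * 1 := by gcongr; exact pow_le_one₀ hc.le hc1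
      _ = 1 := by ring
  have hc5' : c ^ 5 * (2 - c) ^ 2 ≤ 1 := by
    calc c ^ 5 * (2 - c) ^ 2 = c ^ 3 * ((c * (2 - c)) * (c * (2 - c))) := by ring
      _ ≤ 1 * (1 * 1) := by gcongr
      _ = 1 := by ring
  have hGbound : (2 - c) * G ≤ N - 1 := by
    have : 0 ≤ (N - 2) * (1 - c ^ 5 * (2 - c)) := by apply mul_nonneg <;> linarith
    rw [hG]; nlinarith
  have hG1 : G ≤ N - 1 := by nlinarith
  -- assemble
  set β := c - 5 / 7 * c ^ 2 / (N - c) with hβ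
  have hβc : β ≤ c := by
    have : 0 ≤ 5 / 7 * c ^ 2 / (N - c) := by positivity
    linarith
  have hGβ : G * β = c * G - 5 / 7 * c ^ 7 := by
    rw [hβ, hG]; field_simp
  have h1 : (N - G) * (N - G) + G * β ≤ A * A + (N - A) * β := by
    have : 0 ≤ (A - (N - G)) * (A + (N - G) - β) := by apply mul_nonneg <;> linarith
    nlinarith
  have h2 : 0 ≤ (N - G - 1) * (N - G - 1) := mul_self_nonneg _
  have e : A * (σ - t ^ 3) + 5 / 7 * t ^ 7 + (N - A) * (c - t ^ 3 - 5 / 7 * c ^ 2 / (N - c)) =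
      A * σ - N * t ^ 3 + 5 / 7 * t ^ 7 + (N - A) * β := by rw [hβ]; ring
  rw [e]
  nlinarith

/-- For `c ≥ 1` well below `N`, the expression `c - 5/7 c² / (N - c)` is smallest at `c = 1`. If
that value `β` is below `t ^ 3`, the bound increases with `A`, so `A` can be lowered to `t ^ 6` and
then `N` to `16/5`. -/
lemma speed_core_large_other {N t σ c : ℝ} (hN : 2 ≤ N) (ht : 0 < t) (ht1 : t ≤ 1) (hσ : t ≤ σ)
    (hc : 1 ≤ c) (hNc : 16 / 5 * c ≤ N) (hm0 : 0 ≤ N - t ^ 5 * σ) :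
    0 ≤ t ^ 5 * σ * (σ - t ^ 3) + 5 / 7 * t ^ 7
      + (N - t ^ 5 * σ) * (c - t ^ 3 - 5 / 7 * c ^ 2 / (N - c)) := by
  set A := t ^ 5 * σ with hA
  have hNc' : 0 < N - c := by linarith
  have hN1 : 11 / 5 ≤ N - 1 := by linarith
  set β := 1 - 5 / 7 / (N - 1) with hβ
  have hmono : β ≤ c - 5 / 7 * c ^ 2 / (N - c) := by
    have : c - 5 / 7 * c ^ 2 / (N - c) - β =
        (c - 1) * (1 - 5 / 7 * ((N * (c + 1) - c) / ((N - c) * (N - 1)))) := by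
      rw [hβ]; field_simp [show N - 1 ≠ 0 by linarith]; ring
    have h2 : (N * (c + 1) - c) / ((N - c) * (N - 1)) ≤ 7 / 5 := by
      rw [div_le_iff₀ (mul_pos hNc' (by linarith))]; nlinarith
    have : 0 ≤ (c - 1) * (1 - 5 / 7 * ((N * (c + 1) - c) / ((N - c) * (N - 1)))) := by
      apply mul_nonneg <;> linarith
    linarith
  have h3t : t ^ 3 ≤ t := by simpa using pow_le_pow_of_le_one ht.le ht1 (show 1 ≤ 3 by norm_num)
  have hA6 : t ^ 6 ≤ A := by
    calc t ^ 6 = t ^ 5 * t := by ring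
      _ ≤ A := by rw [hA]; gcongr
  have hσ0 : 0 < σ := ht.trans_le hσ
  have hA0 : 0 ≤ A := by positivity
  have step : 0 ≤ A * (t - t ^ 3) + 5 / 7 * t ^ 7 + (N - A) * (β - t ^ 3) := by
    rcases le_total (t ^ 3) β with h | h
    · have := mul_nonneg hA0 (sub_nonneg.2 h3t)
      have := mul_nonneg hm0 (sub_nonneg.2 h)
      have : 0 ≤ t ^ 7 := by positivity
      linarith
    · have h0 : 0 ≤ (A - t ^ 6) * (t - β) := mul_nonneg (by linarith) (by linarith)
      have ht6 : 0 ≤ 1 - t ^ 6 := by linarith [pow_le_one₀ (n := 6) ht.le ht1]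
      have h1 : (N - t ^ 6) / (N - 1) ≤ 1 + (1 - t ^ 6) / (11 / 5) := by
        have : (N - t ^ 6) / (N - 1) = 1 + (1 - t ^ 6) / (N - 1) := by
          field_simp [show N - 1 ≠ 0 by linarith]; ring
        rw [this]; gcongr
      have h2 : (N - t ^ 6) * β = N - t ^ 6 - 5 / 7 * ((N - t ^ 6) / (N - 1)) := by
        rw [hβ]; ring
      have h3 : 0 ≤ (N - 16 / 5) * (1 - t ^ 3) := mul_nonneg (by linarith) (by linarith)
      have h4 : 0 ≤ 16 / 5 * (1 - t ^ 3) - t ^ 6 + t ^ 7 - 5 / 7 * (1 - t ^ 7)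
          - 25 / 77 * (1 - t ^ 6) := by
        have e : 16 / 5 * (1 - t ^ 3) - t ^ 6 + t ^ 7 - 5 / 7 * (1 - t ^ 7)
            - 25 / 77 * (1 - t ^ 6) = (1 - t) * (16 / 5 * (1 + t + t ^ 2) - t ^ 6
            - 5 / 7 * (1 + t + t ^ 2 + t ^ 3 + t ^ 4 + t ^ 5 + t ^ 6)
            - 25 / 77 * (1 + t + t ^ 2 + t ^ 3 + t ^ 4 + t ^ 5)) := by ring
        rw [e]
        have p2 : t ^ 2 ≤ t := by simpa using pow_le_pow_of_le_one ht.le ht1 (show 1 ≤ 2 by norm_num)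
        have p3 : t ^ 3 ≤ t ^ 2 := pow_le_pow_of_le_one ht.le ht1 (by norm_num)
        have p4 : t ^ 4 ≤ t ^ 2 := pow_le_pow_of_le_one ht.le ht1 (by norm_num)
        have p5 : t ^ 5 ≤ t ^ 2 := pow_le_pow_of_le_one ht.le ht1 (by norm_num)
        have p6 : t ^ 6 ≤ t ^ 2 := pow_le_pow_of_le_one ht.le ht1 (by norm_num)
        apply mul_nonneg <;> linarith
      nlinarith
  have m1 := mul_le_mul_of_nonneg_left hmono hm0
  have m2 := mul_le_mul_of_nonneg_left hσ hA0
  nlinarith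

/-- Without a strict speed margin for the other state, the margin in `σ` compensates. The expression
`β` is concave in `c`, so it is controlled by the endpoints `c = 1` and `c = N / 2`. The latter
gives `N / 7`, and the two values coincide at `N = 6`, whence the case split. -/
lemma speed_core_small_self {N t σ c : ℝ} (hN : 2 ≤ N) (ht : 0 < t) (ht1 : t ≤ 1)
    (htN : 16 / 5 * t ≤ N) (hσ : 3 / 16 * N + t ≤ σ)
    (hc : 1 ≤ c) (hNc : 2 * c ≤ N) (hm0 : 0 ≤ N - t ^ 5 * σ) :
    0 ≤ t ^ 5 * σ * (σ - t ^ 3) + 5 / 7 * t ^ 7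
      + (N - t ^ 5 * σ) * (c - t ^ 3 - 5 / 7 * c ^ 2 / (N - c)) := by
  set A := t ^ 5 * σ with hA
  have hNc' : 0 < N - c := by linarith
  have hσ0 : 0 < σ := by linarith
  have hA0 : 0 ≤ A := by positivity
  have h3t : t ^ 3 ≤ t := by simpa using pow_le_pow_of_le_one ht.le ht1 (show 1 ≤ 3 by norm_num)
  set β := c - 5 / 7 * c ^ 2 / (N - c) with hβ
  have easy : t ^ 3 ≤ β → 0 ≤ A * (σ - t ^ 3) + 5 / 7 * t ^ 7 + (N - A) * (β - t ^ 3) := by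
    intro h
    have := mul_nonneg hA0 (show 0 ≤ σ - t ^ 3 by linarith)
    have := mul_nonneg hm0 (sub_nonneg.2 h)
    have : 0 ≤ t ^ 7 := by positivity
    linarith
  have e : c - t ^ 3 - 5 / 7 * c ^ 2 / (N - c) = β - t ^ 3 := by rw [hβ]; ring
  rw [e]
  rcases le_total 6 N with h6 | h6
  · have hβ6 : 6 / 7 ≤ β := by
      have : β - 6 / 7 = ((7 * c - 6) * (N - c) - 5 * c ^ 2) / (7 * (N - c)) := by
        rw [hβ]; field_simp; ring
      have h2 : 0 ≤ (7 * c - 6) * (N - c) - 5 * c ^ 2 := by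
        rcases le_total (6 * c) N with h | h
        · nlinarith
        · nlinarith
      have : 0 ≤ β - 6 / 7 := by rw [this]; positivity
      linarith
    rcases le_total (t ^ 3) (6 / 7) with h | h
    · exact easy (by linarith)
    · have ht5 : 18 / 25 ≤ t ^ 5 := by
        have : 6 / 7 ≤ t := by linarith
        have : 36 / 49 ≤ t ^ 2 := by nlinarith
        have h6 : 36 / 49 ≤ t ^ 6 := by nlinarith
        have : t ^ 6 ≤ t ^ 5 := pow_le_pow_of_le_one ht.le ht1 (by norm_num)
        linarith
      have hA1 : 18 / 25 * (3 / 16 * N + 6 / 7) ≤ A := by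
        rw [hA]; gcongr; linarith
      have hs : 3 / 16 * N ≤ σ - t ^ 3 := by linarith
      have h1 := mul_le_mul_of_nonneg_left hs hA0
      have h2 : 0 ≤ (N - A) * (β - t ^ 3 + 1 / 7) :=
        mul_nonneg hm0 (by linarith [pow_le_one₀ (n := 3) ht.le ht1])
      have h3 : 0 ≤ t ^ 7 := by positivity
      nlinarith
  · have hβN : N / 7 ≤ β := by
      have : β - N / 7 = (N - 2 * c) * (6 * c - N) / (7 * (N - c)) := by
        rw [hβ]; field_simp; ring
      have h2 : 0 ≤ (N - 2 * c) * (6 * c - N) := mul_nonneg (by linarith) (by linarith)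
      have : 0 ≤ β - N / 7 := by rw [this]; positivity
      linarith
    have h1 : 0 ≤ (N - A) * (β - N / 7) := mul_nonneg hm0 (by linarith)
    have h2 : t ^ 5 * ((3 / 16 * N + t) * (5 / 112 * N + t)) ≤ A * (σ - N / 7) := by
      rw [hA, mul_assoc]
      apply mul_le_mul_of_nonneg_left _ (by positivity)
      apply mul_le_mul hσ (by linarith) (by linarith) hσ0.le
    -- `N = m t`
    obtain ⟨m, rfl⟩ : ∃ m, N = m * t := ⟨N / t, by field_simp⟩
    have hm : 16 / 5 ≤ m := le_of_mul_le_mul_right htN ht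
    have hK : 5 / 2 ≤ (3 / 16 * m + 1) * (5 / 112 * m + 1) + 5 / 7 := by nlinarith
    have h3 : 0 ≤ 5 / 2 * t ^ 5 - m * t ^ 2 + m ^ 2 / 7 := by
      rcases le_total (9 / 10) t with h | h
      · have : 7 / 4 * t ^ 4 ≤ 5 / 2 * t ^ 5 := by
          have : 0 ≤ t ^ 4 * (5 / 2 * t - 7 / 4) := mul_nonneg (by positivity) (by linarith)
          nlinarith
        nlinarith [sq_nonneg (m - 7 / 2 * t ^ 2)]
      · have : 0 ≤ 5 / 2 * t ^ 5 - 16 / 5 * t ^ 2 + (16 / 5) ^ 2 / 7 := by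
          have : 0 ≤ (t - 4 / 5) ^ 2 * (2 * t ^ 3 + 16 / 5 * t ^ 2 + 96 / 25 * t + 192 / 125) := by
            positivity
          nlinarith
        nlinarith
    have h4 : 0 ≤ t ^ 2 * (5 / 2 * t ^ 5 - m * t ^ 2 + m ^ 2 / 7) := by positivity
    have h5 : 5 / 2 * t ^ 7 ≤ t ^ 7 * ((3 / 16 * m + 1) * (5 / 112 * m + 1) + 5 / 7) := by
      rw [mul_comm]; gcongr
    nlinarith
/-- The momentum balance that bounds the speed of the average of two states relative to a
rarefied one of them: `t`, `T` are the fifth roots of their densities and `c` is the sound speed of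
the second one, in units of the average state. -/
lemma speed_core {N t σ c b T : ℝ} (hN : 2 ≤ N) (ht : 0 < t) (ht1 : t ≤ 1) (hσ : t ≤ σ)
    (hT : 0 < T) (hTc : T ≤ c) (hcb : c ≤ b) (hcNb : c ≤ N - b)
    (hmass : t ^ 5 * σ + T ^ 5 * (N - b) = N)
    (h : 16 / 5 * c ≤ N ∨ 16 / 5 * t ≤ N ∧ 3 / 16 * N + t ≤ σ) :
    0 ≤ t ^ 5 * σ * (σ - t ^ 3) + 5 / 7 * t ^ 7
      + T ^ 5 * ((N - b) * (b - t ^ 3) - 5 / 7 * c ^ 2) := by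
  have hc : 0 < c := hT.trans_le hTc
  have hNb : 0 < N - b := hc.trans_le hcNb
  have hNc : 0 < N - c := by linarith
  have hm0 : 0 ≤ N - t ^ 5 * σ := by
    have : 0 ≤ T ^ 5 * (N - b) := by positivity
    linarith
  have hm : N - t ^ 5 * σ ≤ c ^ 5 * (N - c) := by
    calc N - t ^ 5 * σ = T ^ 5 * (N - b) := by linarith
      _ ≤ c ^ 5 * (N - c) := by gcongr
  have key : 0 ≤ t ^ 5 * σ * (σ - t ^ 3) + 5 / 7 * t ^ 7
      + (N - t ^ 5 * σ) * (c - t ^ 3 - 5 / 7 * c ^ 2 / (N - c)) := by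
    rcases le_total c 1 with h1 | h1
    · exact speed_core_small hN ht ht1 (by linarith) hc h1 hm
    · rcases h with h | ⟨h, h'⟩
      · exact speed_core_large_other hN ht ht1 hσ h1 h hm0
      · exact speed_core_small_self hN ht ht1 h h' h1 (by linarith) hm0
  -- The derivative of the pressure quotient in `b` is below one while `c ≤ N - b`, so the worst
  -- case is `b = c`. Mass balance then eliminates `T`.
  have hcmp : c - 5 / 7 * c ^ 2 / (N - c) ≤ b - 5 / 7 * c ^ 2 / (N - b) := by
    have h1 : c ^ 2 / (N - b) - c ^ 2 / (N - c) = c ^ 2 / ((N - b) * (N - c)) * (b - c) := by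
      field_simp; ring
    have h2 : c ^ 2 / ((N - b) * (N - c)) ≤ 1 := by
      rw [div_le_one (by positivity)]; nlinarith
    have h3 : c ^ 2 / ((N - b) * (N - c)) * (b - c) ≤ 1 * (b - c) := by
      apply mul_le_mul_of_nonneg_right h2; linarith
    have h4 : 5 / 7 * c ^ 2 / (N - b) - 5 / 7 * c ^ 2 / (N - c)
        = 5 / 7 * (c ^ 2 / (N - b) - c ^ 2 / (N - c)) := by ring
    have h5 : 0 ≤ c ^ 2 / ((N - b) * (N - c)) * (b - c) := by
      apply mul_nonneg (by positivity); linarith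
    linarith
  have e : T ^ 5 * ((N - b) * (b - t ^ 3) - 5 / 7 * c ^ 2) =
      (N - t ^ 5 * σ) * (b - t ^ 3 - 5 / 7 * c ^ 2 / (N - b)) := by
    rw [show N - t ^ 5 * σ = T ^ 5 * (N - b) by linarith]
    field_simp
  rw [e]
  have := mul_le_mul_of_nonneg_left hcmp hm0
  nlinarith

/-- The termwise entropy inequality in dimensional form: the average state has density `r` and
isentropic sound speed `C`. -/
lemma scaled_term_nonneg {r C t c e p ρ σ y Y τ : ℝ} (hr : 0 < r) (hC : 0 < C) (ht : 0 < t)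
    (hρ : ρ = t ^ 5 * r) (hc : C * t ≤ c) (he : e = 25 / 14 * c ^ 2) (hp : p = 5 / 7 * ρ * c ^ 2)
    (hY : y ^ 2 ≤ Y) (hστ : σ = τ - y) (hσ : c ≤ σ) (hτ : t < 1 → C * t ^ 3 ≤ τ) :
    0 ≤ ρ * σ * (e + Y / 2 - 5 / 2 * C ^ 2) - p * y + 5 / 7 * r * C ^ 2 * τ := by
  obtain ⟨c, rfl⟩ : ∃ c', c = C * c' := ⟨c / C, by field_simp⟩
  obtain ⟨τ, rfl⟩ : ∃ τ', τ = C * τ' := ⟨τ / C, by field_simp⟩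
  obtain ⟨a, rfl⟩ : ∃ a, y = -(C * a) := ⟨-y / C, by field_simp⟩
  have hc' : t ≤ c := le_of_mul_le_mul_left hc hC
  have hτ' : t < 1 → t ^ 3 ≤ τ := fun h => le_of_mul_le_mul_left (hτ h) hC
  have hσ' : c ≤ τ + a := le_of_mul_le_mul_left (by rw [hστ] at hσ; linarith) hC
  have hσ0 : 0 < σ := by
    have : 0 < C * c := mul_pos hC (ht.trans_le hc')
    linarith
  have hG : 0 ≤ (τ + a) * (25 * (c ^ 2 * t ^ 5) - 35 * t ^ 5 + 10 + 7 * a ^ 2 * t ^ 5)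
      + 10 * (c ^ 2 * t ^ 5 - 1) * a := by
    rcases le_total (c ^ 2 * t ^ 5) 1 with h | h
    · exact compressive_term_nonneg ht hc' h (by linarith) hτ'
    · exact expansive_term_nonneg ht hc' h hσ'
  have h1 : 0 ≤ r * C ^ 3 / 14 * ((τ + a) * (25 * (c ^ 2 * t ^ 5) - 35 * t ^ 5 + 10
      + 7 * a ^ 2 * t ^ 5) + 10 * (c ^ 2 * t ^ 5 - 1) * a) := by positivity
  have h2 : 0 ≤ ρ * σ * (Y - (-(C * a)) ^ 2) / 2 := by
    have : 0 ≤ Y - (-(C * a)) ^ 2 := by linarith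
    have : 0 ≤ ρ := by rw [hρ]; positivity
    positivity
  have e : ρ * σ * (e + Y / 2 - 5 / 2 * C ^ 2) - p * -(C * a) + 5 / 7 * r * C ^ 2 * (C * τ) =
      r * C ^ 3 / 14 * ((τ + a) * (25 * (c ^ 2 * t ^ 5) - 35 * t ^ 5 + 10
      + 7 * a ^ 2 * t ^ 5) + 10 * (c ^ 2 * t ^ 5 - 1) * a)
      + ρ * σ * (Y - (-(C * a)) ^ 2) / 2 := by
    subst he hp hστ hρ; ring
  rw [e]; positivity

/-- In units of the average, both sound speeds and normal speeds fit under `μ`, so the total mass is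
at most `μ ^ 5 * (2 * lam)`, while it must equal `2 * lam`. This supplies `N ≥ 2` for `speed_core`
with `N = 2 * lam`. -/
lemma pair_speed_ge_one {lam μ c₁ c₂ u₁ u₂ t₁ t₂ : ℝ} (ht₁ : 0 < t₁) (ht₂ : 0 < t₂)
    (hc₁ : t₁ ≤ c₁) (hc₂ : t₂ ≤ c₂) (h₁ : |u₁| + c₁ ≤ μ) (h₂ : |u₂| + c₂ ≤ μ) (hμ : μ ≤ lam)
    (hmass : t₁ ^ 5 * (μ - u₁) + t₂ ^ 5 * (2 * lam - μ + u₂) = 2 * lam) : 1 ≤ μ := by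
  have hμ0 : 0 < μ := by have := abs_nonneg u₁; linarith
  have bound : ∀ t u μ' : ℝ, 0 < t → |u| + t ≤ μ → μ ≤ μ' →
      t ^ 5 * (μ' + |u|) ≤ μ ^ 5 * μ' := by
    intro t u μ' ht h hμ'
    have hu := abs_nonneg u
    have h4 : t ^ 4 ≤ μ ^ 4 := by gcongr; linarith
    have h1 : t * (μ' + |u|) ≤ μ * μ' := by nlinarith
    calc t ^ 5 * (μ' + |u|) = t ^ 4 * (t * (μ' + |u|)) := by ring
      _ ≤ μ ^ 4 * (μ * μ') := by
        apply mul_le_mul h4 h1 _ (by positivity)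
        have : 0 ≤ μ' := by linarith
        positivity
      _ = μ ^ 5 * μ' := by ring
  have b₁ := bound t₁ u₁ μ ht₁ (by linarith) le_rfl
  have b₂ := bound t₂ u₂ (2 * lam - μ) ht₂ (by linarith) (by linarith)
  have a₁ : t₁ ^ 5 * (μ - u₁) ≤ t₁ ^ 5 * (μ + |u₁|) := by
    gcongr; linarith [neg_abs_le u₁]
  have a₂ : t₂ ^ 5 * (2 * lam - μ + u₂) ≤ t₂ ^ 5 * (2 * lam - μ + |u₂|) := by
    gcongr; exact le_abs_self _
  have hle : 2 * lam * 1 ≤ 2 * lam * μ ^ 5 := by nlinarith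
  have h5 : 1 ≤ μ ^ 5 := le_of_mul_le_mul_left hle (by linarith)
  by_contra h
  have : μ ^ 5 < 1 := pow_lt_one₀ hμ0.le (not_le.mp h) (by norm_num)
  linarith

/-- Index 1 is the exterior trace and index 2 the interior one; only the latter has the factor
`8/5`. It is the other state in the first bound and the rarefied state itself in the second, which
explains the two alternatives in `speed_core`. -/
lemma pair_speed_bounds {lam μ c₁ c₂ u₁ u₂ t₁ t₂ z : ℝ} (ht₁ : 0 < t₁) (ht₂ : 0 < t₂)
    (hc₁ : t₁ ≤ c₁) (hc₂ : t₂ ≤ c₂) (h₁ : |u₁| + c₁ ≤ μ) (h₂ : |u₂| + c₂ ≤ μ) (hμ : μ ≤ lam)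
    (hlam : 8 / 5 * (|u₂| + c₂) ≤ lam)
    (hmass : t₁ ^ 5 * (μ - u₁) + t₂ ^ 5 * (2 * lam - μ + u₂) = 2 * lam)
    (hmom : t₁ ^ 5 * ((μ - u₁) * u₁ - 5 / 7 * c₁ ^ 2)
      + t₂ ^ 5 * ((2 * lam - μ + u₂) * u₂ + 5 / 7 * c₂ ^ 2) = 2 * lam * z) :
    (t₁ < 1 → t₁ ^ 3 ≤ μ - z) ∧ (t₂ < 1 → t₂ ^ 3 ≤ 2 * lam - μ + z) := by
  have hμ1 := pair_speed_ge_one ht₁ ht₂ hc₁ hc₂ h₁ h₂ hμ hmass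
  have i₁ := neg_abs_le u₁
  have i₁' := le_abs_self u₁
  have i₂ := neg_abs_le u₂
  have i₂' := le_abs_self u₂
  have n₁ := abs_nonneg u₁
  have n₂ := abs_nonneg u₂
  constructor
  · intro h
    have key := speed_core (N := 2 * lam) (t := t₁) (σ := μ - u₁) (c := c₂) (b := μ - u₂)
      (T := t₂) (by linarith) ht₁ h.le (by linarith) ht₂ hc₂ (by linarith) (by linarith)
      (by linarith) (Or.inl (by linarith))
    have hc : t₁ ^ 7 ≤ t₁ ^ 5 * c₁ ^ 2 := by
      calc t₁ ^ 7 = t₁ ^ 5 * t₁ ^ 2 := by ring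
        _ ≤ t₁ ^ 5 * c₁ ^ 2 := by gcongr
    have : 0 ≤ (2 * lam) * (μ - z - t₁ ^ 3) := by
      have e : (2 * lam) * (μ - z - t₁ ^ 3) = (2 * lam) * (μ - t₁ ^ 3) - 2 * lam * z := by ring
      rw [e, ← hmom]
      nth_rewrite 1 [← hmass]
      nlinarith
    linarith [nonneg_of_mul_nonneg_right this (by linarith)]
  · intro h
    have key := speed_core (N := 2 * lam) (t := t₂) (σ := 2 * lam - μ + u₂) (c := c₁)
      (b := 2 * lam - μ + u₁) (T := t₁) (by linarith) ht₂ h.le (by linarith) ht₁ hc₁ (by linarith)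
      (by linarith) (by linarith) (Or.inr ⟨by linarith, by linarith⟩)
    have hc : t₂ ^ 7 ≤ t₂ ^ 5 * c₂ ^ 2 := by
      calc t₂ ^ 7 = t₂ ^ 5 * t₂ ^ 2 := by ring
        _ ≤ t₂ ^ 5 * c₂ ^ 2 := by gcongr
    have : 0 ≤ (2 * lam) * (2 * lam - μ + z - t₂ ^ 3) := by
      have e : (2 * lam) * (2 * lam - μ + z - t₂ ^ 3) =
        (2 * lam) * (2 * lam - μ - t₂ ^ 3) + 2 * lam * z := by ring
      rw [e, ← hmom]
      nth_rewrite 1 [← hmass]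
      nlinarith
    linarith [nonneg_of_mul_nonneg_right this (by linarith)]

/-- The speed bound for the pair, in dimensional form. -/
lemma scaled_pair_speed_bounds {r C lam μ c₁ c₂ u₁ u₂ t₁ t₂ z : ℝ} (hr : 0 < r) (hC : 0 < C)
    (ht₁ : 0 < t₁) (ht₂ : 0 < t₂)
    (hc₁ : C * t₁ ≤ c₁) (hc₂ : C * t₂ ≤ c₂) (h₁ : |u₁| + c₁ ≤ μ) (h₂ : |u₂| + c₂ ≤ μ)
    (hμ : μ ≤ lam) (hlam : 8 / 5 * (|u₂| + c₂) ≤ lam)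
    (hmass : t₁ ^ 5 * r * (μ - u₁) + t₂ ^ 5 * r * (2 * lam - μ + u₂) = 2 * lam * r)
    (hmom : t₁ ^ 5 * r * ((μ - u₁) * u₁ - 5 / 7 * c₁ ^ 2)
      + t₂ ^ 5 * r * ((2 * lam - μ + u₂) * u₂ + 5 / 7 * c₂ ^ 2) = 2 * lam * r * z) :
    (t₁ < 1 → C * t₁ ^ 3 ≤ μ - z) ∧ (t₂ < 1 → C * t₂ ^ 3 ≤ 2 * lam - μ + z) := by
  obtain ⟨c₁, rfl⟩ : ∃ x, c₁ = C * x := ⟨c₁ / C, by field_simp⟩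
  obtain ⟨c₂, rfl⟩ : ∃ x, c₂ = C * x := ⟨c₂ / C, by field_simp⟩
  obtain ⟨u₁, rfl⟩ : ∃ x, u₁ = C * x := ⟨u₁ / C, by field_simp⟩
  obtain ⟨u₂, rfl⟩ : ∃ x, u₂ = C * x := ⟨u₂ / C, by field_simp⟩
  obtain ⟨μ, rfl⟩ : ∃ x, μ = C * x := ⟨μ / C, by field_simp⟩
  obtain ⟨lam, rfl⟩ : ∃ x, lam = C * x := ⟨lam / C, by field_simp⟩
  obtain ⟨z, rfl⟩ : ∃ x, z = C * x := ⟨z / C, by field_simp⟩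
  rw [abs_mul, abs_of_pos hC] at h₁ h₂ hlam
  have cancel : ∀ {x y : ℝ}, C * x ≤ C * y → x ≤ y := fun h => le_of_mul_le_mul_left h hC
  have key := pair_speed_bounds (lam := lam) (μ := μ) (u₁ := u₁) (u₂ := u₂) (z := z)
    ht₁ ht₂ (cancel hc₁) (cancel hc₂)
    (cancel (by linarith)) (cancel (by linarith)) (cancel hμ)
    (cancel (by linarith))
    (mul_left_cancel₀ (mul_pos hC hr).ne' (by linear_combination hmass))
    (mul_left_cancel₀ (mul_pos (mul_pos hC hC) hr).ne' (by linear_combination hmom))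
  refine ⟨fun h => ?_, fun h => ?_⟩
  · have := mul_le_mul_of_nonneg_left (key.1 h) hC.le
    linarith
  · have := mul_le_mul_of_nonneg_left (key.2 h) hC.le
    linarith

/-! ### Speed bound for the closed-surface average -/

/-- A multiplier argument: each momentum term is bounded below by `1/5` of its mass excess, and the
excesses cancel after summation by mass balance. -/
lemma closed_surface_term_bound {lam t c w ν α β : ℝ} (ht : 0 < t) (hc : t ≤ c)
    (hlam : 8 / 5 * (w + c) ≤ lam) (hν : |ν| ≤ w) (hα : α ≤ w) (hβ : -1 ≤ β) :
    1 / 5 * (t ^ 5 * (lam - ν) - lam) ≤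
      t ^ 5 * ((lam - ν) * (lam - α - 1) + 5 / 7 * c ^ 2 * β) := by
  obtain ⟨hν1, hν2⟩ := abs_le.1 hν
  have hw : 0 ≤ w := (abs_nonneg ν).trans hν
  have hc0 : 0 < c := ht.trans_le hc
  have hlam0 : 0 < lam := by linarith
  set σ := lam - ν with hσ
  have hσc : 8 / 5 * c ≤ σ := by linarith
  have hσ0 : 0 < σ := by linarith
  -- Since `c ≤ 5/8 σ`, the pressure costs at most `9/20 * c * σ`; subtracting this from the margin
  -- `8/5 * c + 3/5 * w` leaves `k`.
  set k := 23 / 20 * c + 3 / 5 * w with hk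
  have h1 : σ * (k - 1) ≤ σ * (lam - α - 1) + 5 / 7 * c ^ 2 * β := by
    have : 5 / 7 * c ^ 2 * β ≥ - (5 / 7 * c ^ 2) := by nlinarith [sq_nonneg c]
    nlinarith
  have h2 : 0 ≤ t ^ 5 * σ * (5 * k - 6) + lam := by
    rcases le_total σ lam with h | h
    · have hkt : t ≤ k := by linarith
      have := mul_nonneg hσ0.le (sub_nonneg.2 (six_mul_pow_five_le t ht.le))
      have : t ^ 5 * σ * (5 * t - 6) ≤ t ^ 5 * σ * (5 * k - 6) := by gcongr
      nlinarith
    -- For inflow `σ ≥ lam`, the sextic inequality is applied at `t * s` instead of `t`;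
    -- multiplication by `s ^ 4` makes the terms match.
    · obtain ⟨s, hs⟩ : ∃ s, σ = s * lam := ⟨σ / lam, by field_simp⟩
      have hs1 : 1 ≤ s := by
        by_contra h'
        nlinarith [not_le.mp h']
      have hts : t * s ≤ k := by
        have : lam * (t * s) ≤ lam * k := by
          have e : lam * (t * s) = t * σ := by rw [hs]; ring
          rw [e]
          have : t * σ ≤ c * (lam + w) := by
            apply mul_le_mul hc (by linarith) hσ0.le hc0.le
          nlinarith [mul_nonneg hc0.le hw]
        exact le_of_mul_le_mul_left this hlam0
      have hx := six_mul_pow_five_le (t * s) (by positivity)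
      have hs4 : 1 ≤ s ^ 4 := one_le_pow₀ hs1
      have h3 : 0 ≤ 5 * t ^ 6 * s ^ 2 - 6 * t ^ 5 * s + 1 := by
        have : 0 ≤ s ^ 4 * (5 * t ^ 6 * s ^ 2 - 6 * t ^ 5 * s + 1) := by nlinarith
        exact nonneg_of_mul_nonneg_right this (by positivity)
      have h4 : t ^ 5 * σ * (5 * (t * s) - 6) ≤ t ^ 5 * σ * (5 * k - 6) := by gcongr
      have h5 : t ^ 5 * σ * (5 * (t * s) - 6) + lam =
          lam * (5 * t ^ 6 * s ^ 2 - 6 * t ^ 5 * s + 1) := by rw [hs]; ring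
      have := mul_nonneg hlam0.le h3
      linarith
  have h3 := mul_le_mul_of_nonneg_left h1 (show 0 ≤ t ^ 5 by positivity)
  nlinarith

lemma closed_surface_speed_bound {ι : Type*} [Fintype ι] {lam z : ℝ} {ζ t c w ν α β : ι → ℝ}
    (hζ : ∀ j, 0 ≤ ζ j) (hZ : 0 < ∑ j, ζ j) (hlam0 : 0 < lam)
    (ht : ∀ j, 0 < t j) (hc : ∀ j, t j ≤ c j) (hlam : ∀ j, 8 / 5 * (w j + c j) ≤ lam)
    (hν : ∀ j, |ν j| ≤ w j) (hα : ∀ j, α j ≤ w j) (hβ : ∀ j, -1 ≤ β j)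
    (hmass : ∑ j, ζ j * (t j ^ 5 * (lam - ν j)) = lam * ∑ j, ζ j)
    (hmom : ∑ j, ζ j * (t j ^ 5 * ((lam - ν j) * α j - 5 / 7 * c j ^ 2 * β j)) =
      lam * (∑ j, ζ j) * z) :
    1 ≤ lam - z := by
  have h : ∑ j, ζ j * (1 / 5 * (t j ^ 5 * (lam - ν j) - lam)) ≤
      ∑ j, ζ j * (t j ^ 5 * ((lam - ν j) * (lam - α j - 1) + 5 / 7 * c j ^ 2 * β j)) :=
    Finset.sum_le_sum fun j _ => mul_le_mul_of_nonneg_left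
      (closed_surface_term_bound (ht j) (hc j) (hlam j) (hν j) (hα j) (hβ j)) (hζ j)
  have e1 : ∑ j, ζ j * (1 / 5 * (t j ^ 5 * (lam - ν j) - lam)) =
      1 / 5 * (∑ j, ζ j * (t j ^ 5 * (lam - ν j)) - lam * ∑ j, ζ j) := by
    rw [Finset.mul_sum, ← Finset.sum_sub_distrib, Finset.mul_sum]
    exact Finset.sum_congr rfl fun j _ => by ring
  have e2 : ∑ j, ζ j * (t j ^ 5 * ((lam - ν j) * (lam - α j - 1) + 5 / 7 * c j ^ 2 * β j)) =
      (lam - 1) * ∑ j, ζ j * (t j ^ 5 * (lam - ν j))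
      - ∑ j, ζ j * (t j ^ 5 * ((lam - ν j) * α j - 5 / 7 * c j ^ 2 * β j)) := by
    rw [Finset.mul_sum, ← Finset.sum_sub_distrib]
    exact Finset.sum_congr rfl fun j _ => by ring
  rw [e1, e2, hmass, hmom, sub_self, mul_zero] at h
  have : 0 ≤ (lam * ∑ j, ζ j) * (lam - 1 - z) := by linarith
  linarith [nonneg_of_mul_nonneg_right this (by positivity)]

section States

variable {d : ℕ}

/-! ### States with bounded-below entropy -/

/-- Internal energy per unit volume. -/
def internalEnergy (U : State d) : ℝ := energy U - density U * ‖velocity U‖ ^ 2 / 2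

/-- The states of positive density whose internal energy is at least the isentropic one,
`κ ρ^(7/5)`. -/
def MinEntropy (κ : ℝ) (U : State d) : Prop :=
  0 < density U ∧ ∃ x, 0 < x ∧ x ^ 5 = density U ∧ κ * x ^ 2 * density U ≤ internalEnergy U

lemma pressure_eq (U : State d) : pressure U = 2 / 5 * internalEnergy U := by
  simp only [pressure, gasGamma, internalEnergy]; norm_num

@[simp] lemma density_add (U V : State d) : density (U + V) = density U + density V := rfl
@[simp] lemma density_sub (U V : State d) : density (U - V) = density U - density V := rfl
@[simp] lemma density_smul (a : ℝ) (U : State d) : density (a • U) = a * density U := rfl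
@[simp] lemma momentum_add (U V : State d) : momentum (U + V) = momentum U + momentum V := rfl
@[simp] lemma momentum_sub (U V : State d) : momentum (U - V) = momentum U - momentum V := rfl
@[simp] lemma momentum_smul (a : ℝ) (U : State d) : momentum (a • U) = a • momentum U := rfl
@[simp] lemma energy_add (U V : State d) : energy (U + V) = energy U + energy V := rfl
@[simp] lemma energy_smul (a : ℝ) (U : State d) : energy (a • U) = a * energy U := rfl

lemma density_sum {ι : Type*} (s : Finset ι) (f : ι → State d) :
    density (∑ i ∈ s, f i) = ∑ i ∈ s, density (f i) := Prod.fst_sum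

lemma momentum_sum {ι : Type*} (s : Finset ι) (f : ι → State d) :
    momentum (∑ i ∈ s, f i) = ∑ i ∈ s, momentum (f i) := by
  simp only [momentum, Prod.snd_sum, Prod.fst_sum]

lemma momentum_eq {U : State d} (h : density U ≠ 0) :
    momentum U = density U • velocity U := by
  simp [velocity, smul_smul, h]

@[simp] lemma density_flux (U : State d) (a : Space d) :
    density (flux U a) = density U * inner ℝ (velocity U) a := rfl

@[simp] lemma momentum_flux (U : State d) (a : Space d) :
    momentum (flux U a) =
      (density U * inner ℝ (velocity U) a) • velocity U + pressure U • a := rfl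

lemma flux_add_right (U : State d) (a b : Space d) : flux U (a + b) = flux U a + flux U b := by
  simp only [flux, inner_add_right]
  ext
  · simp; ring
  · simp; ring
  · simp; ring

lemma flux_smul_right (U : State d) (c : ℝ) (a : Space d) : flux U (c • a) = c • flux U a := by
  simp only [flux, inner_smul_right]
  ext
  · simp; ring
  · simp; ring
  · simp; ring

lemma flux_neg (U : State d) (a : Space d) : flux U (-a) = - flux U a := by
  have := flux_smul_right U (-1) a
  simpa using this

/-- The linear part of the supporting functional of the entropy set at a state with velocity `z`
and isentropic enthalpy `h`. -/
def supportFunctional (h : ℝ) (z : Space d) : State d →ₗ[ℝ] ℝ where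
  toFun U := energy U - inner ℝ z (momentum U) + (‖z‖ ^ 2 / 2 - h) * density U
  map_add' U V := by simp [inner_add_right]; ring
  map_smul' a U := by simp [inner_smul_right]; ring

lemma supportFunctional_eq (h : ℝ) (z : Space d) {U : State d} (hU : density U ≠ 0) :
    supportFunctional h z U =
      internalEnergy U + density U * (‖velocity U - z‖ ^ 2 / 2 - h) := by
  simp only [supportFunctional, LinearMap.coe_mk, AddHom.coe_mk, internalEnergy,
    momentum_eq hU, inner_smul_right, norm_sub_sq_real, real_inner_comm z]
  ring

/-- The flux transports the functional with the normal velocity; the only extra contribution is the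
pressure work relative to `z`. -/
lemma supportFunctional_flux (h : ℝ) (z : Space d) {U : State d} (hU : density U ≠ 0)
    (a : Space d) :
    supportFunctional h z (flux U a) = inner ℝ (velocity U) a * supportFunctional h z U
      + pressure U * inner ℝ (velocity U - z) a := by
  simp only [supportFunctional, LinearMap.coe_mk, AddHom.coe_mk, flux, momentum_eq hU]
  simp only [energy, momentum, density, inner_add_right, inner_smul_right, inner_sub_left]
  ring

/-- Normalization by a reference isentropic state of density `X ^ 5` and sound speed `C`: `t` is the
ratio of fifth roots, and the entropy bound becomes `C * t ≤ soundSpeed U`. -/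
lemma MinEntropy.data {κ X C : ℝ} (hX : 0 < X) (hC : 0 < C) (hCX : C ^ 2 = 14 / 25 * κ * X ^ 2)
    {U : State d} (hU : MinEntropy κ U) :
    ∃ t, 0 < t ∧ density U = t ^ 5 * X ^ 5 ∧ C * t ≤ soundSpeed U ∧
      internalEnergy U = density U * (25 / 14 * soundSpeed U ^ 2) ∧
      pressure U = 5 / 7 * density U * soundSpeed U ^ 2 := by
  obtain ⟨hρ, x, hx, hxρ, hκ⟩ := hU
  have hκ0 : 0 < κ := by
    by_contra hκ
    have : 14 / 25 * κ * X ^ 2 ≤ 0 := by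
      apply mul_nonpos_of_nonpos_of_nonneg <;> [linarith; positivity]
    have : 0 < C ^ 2 := by positivity
    linarith
  have hI : 0 < internalEnergy U := lt_of_lt_of_le (by positivity) hκ
  have hsq : soundSpeed U ^ 2 = 14 / 25 * internalEnergy U / density U := by
    rw [soundSpeed, Real.sq_sqrt, pressure_eq, gasGamma]
    · ring
    · rw [pressure_eq, gasGamma]; positivity
  refine ⟨x / X, by positivity, by rw [← hxρ]; field_simp, ?_, ?_, ?_⟩
  · refine (pow_le_pow_iff_left₀ (by positivity) (Real.sqrt_nonneg _) two_ne_zero).1 ?_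
    change (C * (x / X)) ^ 2 ≤ soundSpeed U ^ 2
    rw [hsq, mul_pow, hCX, le_div_iff₀ hρ]
    have : 14 / 25 * κ * X ^ 2 * (x / X) ^ 2 = 14 / 25 * (κ * x ^ 2) := by field_simp
    rw [this]; linarith
  · rw [hsq]; field_simp
  · rw [hsq, pressure_eq]; field_simp; ring

/-- A state belongs to the entropy set when its own supporting functional says so. -/
lemma minEntropy_of_supportFunctional_nonneg {κ X C : ℝ} (hX : 0 < X)
    (hCX : C ^ 2 = 14 / 25 * κ * X ^ 2) {V : State d} (hV : X ^ 5 = density V)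
    (h : 0 ≤ supportFunctional (5 / 2 * C ^ 2) (velocity V) V + 5 / 7 * X ^ 5 * C ^ 2) :
    MinEntropy κ V := by
  have hρ : 0 < density V := by rw [← hV]; positivity
  refine ⟨hρ, X, hX, hV, ?_⟩
  rw [supportFunctional_eq _ _ hρ.ne', sub_self, norm_zero, hV, hCX] at h
  nlinarith

lemma exists_fifth_root_and_speed {κ ρ : ℝ} (hκ : 0 < κ) (hρ : 0 < ρ) :
    ∃ X C : ℝ, 0 < X ∧ 0 < C ∧ X ^ 5 = ρ ∧ C ^ 2 = 14 / 25 * κ * X ^ 2 := by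
  refine ⟨ρ ^ ((1 : ℝ) / 5), √(14 / 25 * κ * (ρ ^ ((1 : ℝ) / 5)) ^ 2), by positivity,
    by positivity, ?_, Real.sq_sqrt (by positivity)⟩
  rw [← Real.rpow_natCast, ← Real.rpow_mul hρ.le]; norm_num

lemma MinEntropy.soundSpeed_pos {κ : ℝ} (hκ : 0 < κ) {U : State d} (hU : MinEntropy κ U) :
    0 < soundSpeed U := by
  obtain ⟨X, C, hX, hC, -, hCX⟩ := exists_fifth_root_and_speed hκ one_pos
  obtain ⟨t, ht, -, hc, -⟩ := hU.data hX hC hCX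
  exact lt_of_lt_of_le (by positivity) hc

/-- The contribution of one state to the supporting functional of a flux-corrected average. -/
lemma supportFunctional_flux_term_nonneg {κ X C lam : ℝ} (hX : 0 < X) (hC : 0 < C)
    (hCX : C ^ 2 = 14 / 25 * κ * X ^ 2) {U : State d} (hU : MinEntropy κ U) {a z : Space d}
    (ha : ‖a‖ = 1) (hlam : soundSpeed U ≤ lam - inner ℝ (velocity U) a)
    (hτ : ∀ t, 0 < t → density U = t ^ 5 * X ^ 5 → t < 1 → C * t ^ 3 ≤ lam - inner ℝ z a) :
    0 ≤ supportFunctional (5 / 2 * C ^ 2) z (lam • U - flux U a)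
      + 5 / 7 * X ^ 5 * C ^ 2 * (lam - inner ℝ z a) := by
  obtain ⟨t, ht, hρ, hc, hI, hp⟩ := hU.data hX hC hCX
  have hY : (inner ℝ (velocity U - z) a) ^ 2 ≤ ‖velocity U - z‖ ^ 2 := by
    rw [← sq_abs]
    have := abs_real_inner_le_norm (velocity U - z) a
    rw [ha, mul_one] at this
    gcongr
  have key := scaled_term_nonneg (r := X ^ 5) (by positivity) hC ht hρ hc rfl hp hY
    (σ := lam - inner ℝ (velocity U) a) (τ := lam - inner ℝ z a)
    (by rw [inner_sub_left]; ring) hlam (hτ t ht hρ)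
  have hρ0 := hU.1.ne'
  rw [map_sub, map_smul, supportFunctional_flux _ _ hρ0, supportFunctional_eq _ _ hρ0, hI,
    smul_eq_mul]
  linarith

/-- The tangent-plane inequality for `κ ρ^(7/5)` at density `X ^ 5`; the kinetic term relative to
`z` only helps. The constant `5/7 * X ^ 5 * C ^ 2` is the isentropic pressure at that density. -/
lemma supportFunctional_add_const_nonneg {κ X C : ℝ} (hX : 0 < X) (hC : 0 < C)
    (hCX : C ^ 2 = 14 / 25 * κ * X ^ 2) {U : State d} (hU : MinEntropy κ U) (z : Space d) :
    0 ≤ supportFunctional (5 / 2 * C ^ 2) z U + 5 / 7 * X ^ 5 * C ^ 2 := by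
  obtain ⟨t, ht, hρ, hc, hI, hp⟩ := hU.data hX hC hCX
  rw [supportFunctional_eq _ _ hU.1.ne', hI, hρ]
  have hgap := isentropic_gap_nonneg t ht.le
  have h1 : (C * t) ^ 2 ≤ soundSpeed U ^ 2 := by gcongr
  have h2 : t ^ 5 * X ^ 5 * (25 / 14 * (C * t) ^ 2) ≤
    t ^ 5 * X ^ 5 * (25 / 14 * soundSpeed U ^ 2) := by gcongr
  have h3 : 0 ≤ X ^ 5 * C ^ 2 / 14 * (25 * t ^ 7 - 35 * t ^ 5 + 10) := by positivity
  have h4 : 0 ≤ t ^ 5 * X ^ 5 * (‖velocity U - z‖ ^ 2 / 2) := by positivity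
  nlinarith

/-- The combination is tested against its own supporting functional, which is nonnegative, after
adding the pressure constant, at both endpoints. -/
lemma convex_minEntropy {κ : ℝ} (hκ : 0 < κ) : Convex ℝ {U : State d | MinEntropy κ U} := by
  intro U hU V hV a b ha hb hab
  have hρ : 0 < density (a • U + b • V) := by
    have := convex_Ioi (0 : ℝ) hU.1 hV.1 ha hb hab
    simpa using this
  obtain ⟨X, C, hX, hC, hXρ, hCX⟩ := exists_fifth_root_and_speed hκ hρ
  apply minEntropy_of_supportFunctional_nonneg hX hCX hXρ
  have hU' := mul_nonneg ha (supportFunctional_add_const_nonneg hX hC hCX hU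
    (velocity (a • U + b • V)))
  have hV' := mul_nonneg hb (supportFunctional_add_const_nonneg hX hC hCX hV
    (velocity (a • U + b • V)))
  rw [map_add, map_smul, map_smul, smul_eq_mul, smul_eq_mul]
  have : 5 / 7 * X ^ 5 * C ^ 2 = (a + b) * (5 / 7 * X ^ 5 * C ^ 2) := by rw [hab, one_mul]
  rw [this]
  linarith

/-! ### Flux-corrected averages of states -/

lemma abs_inner_velocity_le (U : State d) {a : Space d} (ha : ‖a‖ = 1) :
    |inner ℝ (velocity U) a| ≤ ‖velocity U‖ := by
  simpa [ha] using abs_real_inner_le_norm (velocity U) a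

lemma fifth_root_unique {t s X ρ : ℝ} (hX : 0 < X) (ht : 0 < t) (hs : 0 < s)
    (h₁ : ρ = t ^ 5 * X ^ 5) (h₂ : ρ = s ^ 5 * X ^ 5) : t = s := by
  have : t ^ 5 = s ^ 5 := mul_right_cancel₀ (pow_pos hX 5).ne' (h₁.symm.trans h₂)
  exact (pow_left_inj₀ ht.le hs.le (by norm_num)).1 this

/-- The two halves of a Lax–Friedrichs flux, with enough of the interior state added, average to
a state that satisfies the minimum entropy principle. -/
lemma minEntropy_pair {κ lam μ : ℝ} (hκ : 0 < κ) {P Q : State d} (hP : MinEntropy κ P)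
    (hQ : MinEntropy κ Q) {a : Space d} (ha : ‖a‖ = 1) (hμP : waveSpeed P ≤ μ)
    (hμQ : waveSpeed Q ≤ μ) (hμ : μ ≤ lam) (hlam : 8 / 5 * waveSpeed P ≤ lam) :
    MinEntropy κ ((2 * lam)⁻¹ • ((μ • Q - flux Q a) + ((2 * lam - μ) • P + flux P a))) := by
  have hPa := abs_inner_velocity_le P ha
  have hQa := abs_inner_velocity_le Q ha
  obtain ⟨hPa1, hPa2⟩ := abs_le.1 hPa
  obtain ⟨hQa1, hQa2⟩ := abs_le.1 hQa
  simp only [waveSpeed] at hμP hμQ hlam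
  have hcP := hP.soundSpeed_pos hκ
  have hcQ := hQ.soundSpeed_pos hκ
  have hlam0 : 0 < lam := by linarith [norm_nonneg (velocity P)]
  set V := (2 * lam)⁻¹ • ((μ • Q - flux Q a) + ((2 * lam - μ) • P + flux P a)) with hV
  have hVeq : (2 * lam) • V = (μ • Q - flux Q a) + ((2 * lam - μ) • P + flux P a) := by
    rw [hV, smul_smul, mul_inv_cancel₀ (by positivity), one_smul]
  have hmassV : 2 * lam * density V = density Q * (μ - inner ℝ (velocity Q) a)
      + density P * (2 * lam - μ + inner ℝ (velocity P) a) := by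
    have := congrArg density hVeq
    simp only [density_smul, density_add, density_sub, density_flux] at this
    rw [this]; ring
  have hρV : 0 < density V := by
    have h1 : 0 < density Q * (μ - inner ℝ (velocity Q) a) := mul_pos hQ.1 (by linarith)
    have h2 : 0 < density P * (2 * lam - μ + inner ℝ (velocity P) a) := mul_pos hP.1 (by linarith)
    have h3 : 0 < 2 * lam * density V := by rw [hmassV]; positivity
    exact pos_of_mul_pos_right h3 (by positivity)
  obtain ⟨X, C, hX, hC, hXρ, hCX⟩ := exists_fifth_root_and_speed hκ hρV
  apply minEntropy_of_supportFunctional_nonneg hX hCX hXρ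
  set z := velocity V with hz
  obtain ⟨t₁, ht₁, hρ₁, hc₁, -, hp₁⟩ := hQ.data hX hC hCX
  obtain ⟨t₂, ht₂, hρ₂, hc₂, -, hp₂⟩ := hP.data hX hC hCX
  have haa : (inner ℝ a a : ℝ) = 1 := by rw [real_inner_self_eq_norm_sq, ha]; norm_num
  have hmomV : 2 * lam * (density V * inner ℝ z a) =
      density Q * ((μ - inner ℝ (velocity Q) a) * inner ℝ (velocity Q) a
        - 5 / 7 * soundSpeed Q ^ 2)
      + density P * ((2 * lam - μ + inner ℝ (velocity P) a) * inner ℝ (velocity P) a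
        + 5 / 7 * soundSpeed P ^ 2) := by
    have := congrArg (fun m => (inner ℝ m a : ℝ)) (congrArg momentum hVeq)
    simp only [momentum_smul, momentum_add, momentum_sub, momentum_flux, momentum_eq hρV.ne',
      momentum_eq hP.1.ne', momentum_eq hQ.1.ne', inner_add_left, inner_sub_left,
      real_inner_smul_left, haa, hp₁, hp₂] at this
    rw [this]; ring
  obtain ⟨b₁, b₂⟩ := scaled_pair_speed_bounds (r := X ^ 5) (lam := lam) (μ := μ)
    (c₁ := soundSpeed Q) (c₂ := soundSpeed P) (u₁ := inner ℝ (velocity Q) a)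
    (u₂ := inner ℝ (velocity P) a) (z := inner ℝ z a) (by positivity) hC ht₁ ht₂ hc₁ hc₂
    (by linarith) (by linarith) hμ (by linarith)
    (by rw [← hρ₁, ← hρ₂, hXρ, hmassV]) (by rw [← hρ₁, ← hρ₂, ← hmomV, hXρ]; ring)
  have T₁ := supportFunctional_flux_term_nonneg hX hC hCX hQ (z := z) ha (lam := μ) (by linarith)
    (fun t ht hρ h => by
      obtain rfl := fifth_root_unique hX ht ht₁ hρ hρ₁
      exact b₁ h)
  -- The interior half is the same kind of term with normal `-a` and dissipation `2 * lam - μ`; the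
  -- two pressure constants then add up to `2 * lam`.
  have T₂ := supportFunctional_flux_term_nonneg hX hC hCX hP (z := z) (a := -a) (by simpa using ha)
    (lam := 2 * lam - μ) (by rw [inner_neg_right]; linarith)
    (fun t ht hρ h => by
      obtain rfl := fifth_root_unique hX ht ht₂ hρ hρ₂
      rw [inner_neg_right, sub_neg_eq_add]
      exact b₂ h)
  rw [flux_neg, sub_neg_eq_add, inner_neg_right] at T₂
  have e : 2 * lam * (supportFunctional (5 / 2 * C ^ 2) z V + 5 / 7 * X ^ 5 * C ^ 2) =
      (supportFunctional (5 / 2 * C ^ 2) z (μ • Q - flux Q a)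
        + 5 / 7 * X ^ 5 * C ^ 2 * (μ - inner ℝ z a))
      + (supportFunctional (5 / 2 * C ^ 2) z ((2 * lam - μ) • P + flux P a)
        + 5 / 7 * X ^ 5 * C ^ 2 * (2 * lam - μ - -inner ℝ z a)) := by
    have := congrArg (supportFunctional (5 / 2 * C ^ 2) z) hVeq
    rw [map_smul, map_add, smul_eq_mul] at this
    linear_combination this
  have h : 0 ≤ 2 * lam * (supportFunctional (5 / 2 * C ^ 2) z V + 5 / 7 * X ^ 5 * C ^ 2) := by
    rw [e]; exact add_nonneg T₁ T₂
  exact nonneg_of_mul_nonneg_right h (by positivity)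

/-- The average over a closed surface of interior states corrected by their outward fluxes
satisfies the minimum entropy principle. -/
lemma minEntropy_closed_surface {ι : Type*} [Fintype ι] {κ lam : ℝ} (hκ : 0 < κ)
    {P : ι → State d} (hP : ∀ j, MinEntropy κ (P j)) {ζ : ι → ℝ} (hζ : ∀ j, 0 ≤ ζ j)
    (hZ : 0 < ∑ j, ζ j) {a : ι → Space d} (ha : ∀ j, ‖a j‖ = 1) (hclosed : ∑ j, ζ j • a j = 0)
    (hlam : ∀ j, 8 / 5 * waveSpeed (P j) ≤ lam) :
    MinEntropy κ ((lam * ∑ j, ζ j)⁻¹ • ∑ j, ζ j • (lam • P j - flux (P j) (a j))) := by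
  have hua : ∀ j b, ‖b‖ = 1 → |inner ℝ (velocity (P j)) b| ≤ ‖velocity (P j)‖ :=
    fun j b hb => abs_inner_velocity_le (P j) hb
  simp only [waveSpeed] at hlam
  have hc : ∀ j, 0 < soundSpeed (P j) := fun j => (hP j).soundSpeed_pos hκ
  have hσ : ∀ j, soundSpeed (P j) ≤ lam - inner ℝ (velocity (P j)) (a j) := fun j => by
    linarith [(abs_le.1 (hua j (a j) (ha j))).2, hlam j, norm_nonneg (velocity (P j)), hc j]
  obtain ⟨j₀, -, hj₀⟩ : ∃ j ∈ Finset.univ, ζ j ≠ 0 := Finset.exists_ne_zero_of_sum_ne_zero hZ.ne'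
  have hj₀' : 0 < ζ j₀ := lt_of_le_of_ne (hζ j₀) hj₀.symm
  have hlam0 : 0 < lam := by linarith [norm_nonneg (velocity (P j₀)), hc j₀, hlam j₀]
  set Z := ∑ j, ζ j with hZdef
  set V := (lam * Z)⁻¹ • ∑ j, ζ j • (lam • P j - flux (P j) (a j)) with hV
  have hVeq : (lam * Z) • V = ∑ j, ζ j • (lam • P j - flux (P j) (a j)) := by
    rw [hV, smul_smul, mul_inv_cancel₀ (by positivity), one_smul]
  have hmassV : lam * Z * density V =
      ∑ j, ζ j * (density (P j) * (lam - inner ℝ (velocity (P j)) (a j))) := by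
    have := congrArg density hVeq
    simp only [density_smul, density_sum, density_sub, density_flux] at this
    rw [this]
    exact Finset.sum_congr rfl fun j _ => by ring
  have hρV : 0 < density V := by
    have h3 : 0 < lam * Z * density V := by
      rw [hmassV]
      have pos : ∀ j, 0 < density (P j) * (lam - inner ℝ (velocity (P j)) (a j)) :=
        fun j => mul_pos (hP j).1 (by linarith [hσ j, hc j])
      exact Finset.sum_pos' (fun j _ => mul_nonneg (hζ j) (pos j).le)
        ⟨j₀, Finset.mem_univ _, mul_pos hj₀' (pos j₀)⟩
    exact pos_of_mul_pos_right h3 (by positivity)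
  obtain ⟨X, C, hX, hC, hXρ, hCX⟩ := exists_fifth_root_and_speed hκ hρV
  apply minEntropy_of_supportFunctional_nonneg hX hCX hXρ
  set z := velocity V with hz
  choose t ht hρ hct hI hp using fun j => (hP j).data hX hC hCX
  -- Projecting the total momentum on each normal `a i` in turn bounds the average's speed in every
  -- face direction. The bound `C` is stronger than the needed `C * t ^ 3`.
  have hspeed : ∀ i, C ≤ lam - inner ℝ z (a i) := fun i => by
    have hmomV : lam * Z * (density V * inner ℝ z (a i)) =
        ∑ j, ζ j * (density (P j) * ((lam - inner ℝ (velocity (P j)) (a j))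
          * inner ℝ (velocity (P j)) (a i)
          - 5 / 7 * soundSpeed (P j) ^ 2 * inner ℝ (a j) (a i))) := by
      have := congrArg (fun m => (inner ℝ m (a i) : ℝ)) (congrArg momentum hVeq)
      simp only [momentum_smul, momentum_sum, momentum_sub, momentum_flux, momentum_eq hρV.ne',
        fun j => momentum_eq (hP j).1.ne', inner_add_left, inner_sub_left, sum_inner,
        real_inner_smul_left, hp] at this
      rw [this]
      exact Finset.sum_congr rfl fun j _ => by ring
    have key := closed_surface_speed_bound (lam := lam / C) (z := inner ℝ z (a i) / C) (ζ := ζ)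
      (t := t) (c := fun j => soundSpeed (P j) / C) (w := fun j => ‖velocity (P j)‖ / C)
      (ν := fun j => inner ℝ (velocity (P j)) (a j) / C)
      (α := fun j => inner ℝ (velocity (P j)) (a i) / C)
      (β := fun j => inner ℝ (a j) (a i)) hζ hZ (by positivity) ht
      (fun j => by rw [le_div_iff₀ hC]; linarith [hct j])
      (fun j => by rw [← add_div, ← mul_div_assoc]; gcongr; exact hlam j)
      (fun j => by rw [abs_div, abs_of_pos hC]; gcongr; exact hua j _ (ha j))
      (fun j => by gcongr; exact (le_abs_self _).trans (hua j _ (ha i)))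
      (fun j => by
        have := abs_real_inner_le_norm (a j) (a i)
        rw [ha, ha, mul_one] at this
        exact (abs_le.1 this).1)
      (by
        have h5 : C * X ^ 5 ≠ 0 := by positivity
        apply mul_left_cancel₀ h5
        rw [Finset.mul_sum]
        have e : C * X ^ 5 * (lam / C * ∑ j, ζ j) = lam * Z * density V := by
          rw [← hZdef, ← hXρ]; field_simp
        rw [e, hmassV]
        refine Finset.sum_congr rfl fun j _ => ?_
        rw [hρ j]; field_simp)
      (by
        have h5 : C ^ 2 * X ^ 5 ≠ 0 := by positivity
        apply mul_left_cancel₀ h5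
        rw [Finset.mul_sum]
        have e : C ^ 2 * X ^ 5 * (lam / C * (∑ j, ζ j) * (inner ℝ z (a i) / C)) =
            lam * Z * (density V * inner ℝ z (a i)) := by
          rw [← hZdef, ← hXρ]; field_simp
        rw [e, hmomV]
        refine Finset.sum_congr rfl fun j _ => ?_
        rw [hρ j]; field_simp)
    rw [← sub_div, le_div_iff₀ hC] at key
    linarith
  have T : ∀ j, 0 ≤ supportFunctional (5 / 2 * C ^ 2) z (lam • P j - flux (P j) (a j))
      + 5 / 7 * X ^ 5 * C ^ 2 * (lam - inner ℝ z (a j)) := fun j =>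
    supportFunctional_flux_term_nonneg hX hC hCX (hP j) (ha j) (hσ j) fun s hs _ hs1 => by
      have : C * s ^ 3 ≤ C * 1 := by gcongr; exact pow_le_one₀ hs.le hs1.le
      linarith [hspeed j]
  have hclosed' : ∑ j, ζ j * inner ℝ z (a j) = 0 := by
    have := congrArg (fun m => (inner ℝ z m : ℝ)) hclosed
    simpa [inner_sum, inner_smul_right] using this
  have e : lam * Z * (supportFunctional (5 / 2 * C ^ 2) z V + 5 / 7 * X ^ 5 * C ^ 2) =
      ∑ j, ζ j * (supportFunctional (5 / 2 * C ^ 2) z (lam • P j - flux (P j) (a j))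
        + 5 / 7 * X ^ 5 * C ^ 2 * (lam - inner ℝ z (a j))) := by
    have := congrArg (supportFunctional (5 / 2 * C ^ 2) z) hVeq
    rw [map_smul, map_sum, smul_eq_mul] at this
    simp only [map_smul, smul_eq_mul] at this
    simp only [mul_add, Finset.sum_add_distrib, ← this]
    have e2 : ∑ j, ζ j * (5 / 7 * X ^ 5 * C ^ 2 * (lam - inner ℝ z (a j))) =
        5 / 7 * X ^ 5 * C ^ 2 * (lam * ∑ j, ζ j - ∑ j, ζ j * inner ℝ z (a j)) := by
      rw [Finset.mul_sum, ← Finset.sum_sub_distrib, Finset.mul_sum]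
      exact Finset.sum_congr rfl fun j _ => by ring
    rw [e2, hclosed']
    ring
  have h : 0 ≤ lam * Z * (supportFunctional (5 / 2 * C ^ 2) z V + 5 / 7 * X ^ 5 * C ^ 2) := by
    rw [e]; exact Finset.sum_nonneg fun j _ => mul_nonneg (hζ j) (T j)
  exact nonneg_of_mul_nonneg_right h (by positivity)

end States

/-! ### Geometry of curved elements -/

namespace Element

variable {n : ℕ} (E : Element n)

lemma continuous_jac : Continuous E.jac :=
  (ContinuousLinearMap.continuous_det.comp
    (E.map_contDiff.continuous_fderiv one_ne_zero)).abs

lemma isCompact_carrier : IsCompact E.carrier := E.ref_compact.image E.map_contDiff.continuous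

lemma vol_pos : 0 < E.vol :=
  ENNReal.toReal_pos E.volume_pos.ne' E.isCompact_carrier.measure_lt_top.ne

lemma setIntegral_carrier {F : Type*} [NormedAddCommGroup F] [NormedSpace ℝ F]
    (g : Space (n + 1) → F) :
    ∫ x in E.carrier, g (E.toRef x) = ∫ r in E.ref, E.jac r • g r := by
  rw [carrier, integral_image_eq_integral_abs_det_fderiv_smul volume
    E.ref_compact.measurableSet (fun r _ =>
      (E.map_contDiff.differentiable one_ne_zero r).hasFDerivAt.hasFDerivWithinAt) E.map_injOn]
  refine setIntegral_congr_fun E.ref_compact.measurableSet fun r hr => ?_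
  simp only [jac, toRef]
  rw [E.map_injOn.leftInvOn_invFunOn hr]

lemma vol_eq_integral_jac : E.vol = ∫ r in E.ref, E.jac r := by
  have := E.setIntegral_carrier (fun _ => (1 : ℝ))
  simpa [vol] using this

lemma continuous_generalizedCross :
    Continuous (generalizedCross : (Fin n → Space (n + 1)) → Space (n + 1)) := by
  unfold generalizedCross
  refine (PiLp.continuous_toLp 2 _).comp (continuous_pi fun i => Continuous.matrix_det ?_)
  refine continuous_matrix fun a b => ?_
  refine Fin.cases ?_ (fun a => ?_) a
  · simpa using continuous_const
  · simp only [Matrix.of_apply, Matrix.cons_val_succ]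
    fun_prop

lemma continuous_surfJac (k : Fin E.numFaces) : Continuous (E.surfJac k) := by
  unfold surfJac hypersurfaceJacobian
  refine Continuous.const_smul (continuous_generalizedCross.comp (continuous_pi fun j => ?_))
    (E.orient k)
  exact ((E.map_contDiff.comp (E.facePar_contDiff k)).continuous_fderiv one_ne_zero).clm_apply
    continuous_const

/-- Gauss–Green for constant vector fields. Exact face quadrature transfers this closedness to the
discrete normals. -/
lemma sum_integral_surfJac_eq_zero : ∑ k, ∫ g in E.face k, E.surfJac k g = 0 := by
  refine ext_inner_left ℝ fun v => ?_
  have h := E.gauss_green (fun _ => v) contDiff_const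
  have h0 : divergence (fun _ : Space (n + 1) => v) = fun _ => 0 := by
    funext x; simp [divergence]
  rw [h0] at h
  simp only [integral_zero] at h
  rw [inner_zero_right, inner_sum, h]
  refine Finset.sum_congr rfl fun k _ => ?_
  exact (integral_inner ((E.continuous_surfJac k).continuousOn.integrableOn_compact
    (E.face_compact k)) v).symm

lemma facePar_mem_ref {k : Fin E.numFaces} {g : Space n} (hg : g ∈ E.face k) :
    E.facePar k g ∈ E.ref := by
  apply E.ref_compact.isClosed.frontier_subset
  rw [E.frontier_eq]
  exact Set.mem_iUnion.2 ⟨k, g, hg, rfl⟩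

lemma ref_nonempty : E.ref.Nonempty := by
  by_contra h
  rw [Set.not_nonempty_iff_eq_empty] at h
  have := E.volume_pos
  simp [h] at this

end Element

/-! ### Quadrature and interpolation identities -/

namespace DGElement

variable {n : ℕ} (E : DGElement n)

lemma integral_jac_smul_sum {F : Type*} [NormedAddCommGroup F] [NormedSpace ℝ F]
    [CompleteSpace F] (c : Fin E.numBasis → F) :
    ∫ r in E.ref, E.jac r • ∑ m, E.basis m r • c m =
      ∑ v, (E.jac (E.volPt v) * E.volWt v) • ∑ m, E.basis m (E.volPt v) • c m := by
  have hint : ∀ m, IntegrableOn (fun r => E.jac r * E.basis m r) E.ref := fun m =>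
    (E.continuous_jac.mul (E.basis_contDiff m).continuous).continuousOn.integrableOn_compact
      E.ref_compact
  simp only [Finset.smul_sum, smul_smul]
  rw [integral_finsetSum _ fun m _ => (hint m).smul_const (c m), Finset.sum_comm]
  refine Finset.sum_congr rfl fun m _ => ?_
  rw [integral_smul_const, E.vol_exact m, Finset.sum_smul]
  exact Finset.sum_congr rfl fun v _ => by ring_nf

lemma average_eq (W : Fin E.numBasis → State (n + 1)) :
    E.average W = E.vol⁻¹ • ∑ v, (E.jac (E.volPt v) * E.volWt v) • E.eval W (E.volPt v) := by
  rw [average, E.setIntegral_carrier (E.eval W)]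
  congr 1
  exact E.integral_jac_smul_sum W

lemma vol_eq_sum : E.vol = ∑ v, E.jac (E.volPt v) * E.volWt v := by
  obtain ⟨c, hc⟩ := E.one_mem_span
  have h := E.integral_jac_smul_sum c
  have hc' : ∀ r, ∑ m, E.basis m r * c m = 1 := fun r => by
    rw [← hc r]; exact Finset.sum_congr rfl fun m _ => mul_comm _ _
  simp only [smul_eq_mul, hc', mul_one] at h
  rw [E.vol_eq_integral_jac, h]

/-- Interpolation at the nodes reproduces the discrete space, so surface traces become linear
combinations of volume point values. -/
lemma sum_lagrange_smul {F : Type*} [AddCommGroup F] [Module ℝ F] (c : Fin E.numBasis → F)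
    (r : Space (n + 1)) :
    ∑ j, E.lagrange j r • ∑ m, E.basis m (E.volPt (E.node j)) • c m =
      ∑ m, E.basis m r • c m := by
  set B := Matrix.of fun m j => E.basis m (E.volPt (E.node j)) with hB
  have hBB : B * B⁻¹ = 1 := Matrix.mul_nonsing_inv _ (isUnit_iff_ne_zero.2 E.node_nonsingular)
  have h1 : ∀ m, ∑ j, E.lagrange j r * B m j = E.basis m r := fun m => by
    calc ∑ j, E.lagrange j r * B m j = ∑ j, ∑ m', B m j * B⁻¹ j m' * E.basis m' r := by
          refine Finset.sum_congr rfl fun j _ => ?_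
          rw [lagrange, Finset.sum_mul]
          exact Finset.sum_congr rfl fun m' _ => by ring
      _ = ∑ m', (B * B⁻¹) m m' * E.basis m' r := by
          rw [Finset.sum_comm]
          exact Finset.sum_congr rfl fun m' _ => by rw [Matrix.mul_apply, Finset.sum_mul]
      _ = E.basis m r := by simp [hBB, Matrix.one_apply]
  simp only [Finset.smul_sum, smul_smul]
  rw [Finset.sum_comm]
  refine Finset.sum_congr rfl fun m _ => ?_
  rw [← h1 m, Finset.sum_smul]
  rfl

lemma sum_volShape_smul {F : Type*} [AddCommGroup F] [Module ℝ F] (G : Fin E.numVol → F)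
    (r : Space (n + 1)) :
    ∑ v, E.volShape v r • G v = ∑ j, E.lagrange j r • G (E.node j) := by
  simp only [volShape, Finset.sum_smul]
  rw [Finset.sum_comm]
  refine Finset.sum_congr rfl fun j _ => ?_
  simp [ite_smul]

lemma sum_volShape_smul_eval (W : Fin E.numBasis → State (n + 1)) (r : Space (n + 1)) :
    ∑ v, E.volShape v r • E.eval W (E.volPt v) = E.eval W r := by
  rw [E.sum_volShape_smul]
  exact E.sum_lagrange_smul W r

lemma sum_volShape (r : Space (n + 1)) : ∑ v, E.volShape v r = 1 := by
  obtain ⟨c, hc⟩ := E.one_mem_span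
  have hc' : ∀ r, ∑ m, E.basis m r • c m = 1 := fun r => by
    rw [← hc r]; exact Finset.sum_congr rfl fun m _ => mul_comm _ _
  have h := E.sum_lagrange_smul c r
  simp only [hc'] at h
  have h2 := E.sum_volShape_smul (fun _ => (1 : ℝ)) r
  rw [h] at h2
  simpa using h2

/-- The decomposition of the element average into volume and surface point values. -/
lemma average_eq_sum_thetaVol (W : Fin E.numBasis → State (n + 1))
    (θ : ∀ k, Fin (E.numSurf k) → ℝ) :
    E.average W = ∑ v, E.thetaVol θ v • E.eval W (E.volPt v)
      + ∑ k, ∑ q, θ k q • E.eval W (E.surfRef k q) := by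
  have h : ∑ v, (∑ k, ∑ q, θ k q * E.volShape v (E.surfRef k q)) • E.eval W (E.volPt v) =
      ∑ k, ∑ q, θ k q • E.eval W (E.surfRef k q) := by
    simp only [Finset.sum_smul]
    rw [Finset.sum_comm]
    refine Finset.sum_congr rfl fun k _ => ?_
    rw [Finset.sum_comm]
    refine Finset.sum_congr rfl fun q _ => ?_
    simp only [mul_smul]
    rw [← Finset.smul_sum, E.sum_volShape_smul_eval]
  simp only [thetaVol, sub_smul, Finset.sum_sub_distrib]
  rw [h, sub_add_cancel, E.average_eq, Finset.smul_sum]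
  refine Finset.sum_congr rfl fun v _ => ?_
  rw [smul_smul, div_eq_inv_mul]

lemma sum_thetaVol (θ : ∀ k, Fin (E.numSurf k) → ℝ) :
    ∑ v, E.thetaVol θ v + ∑ k, ∑ q, θ k q = 1 := by
  have h : ∑ v, ∑ k, ∑ q, θ k q * E.volShape v (E.surfRef k q) = ∑ k, ∑ q, θ k q := by
    rw [Finset.sum_comm]
    refine Finset.sum_congr rfl fun k _ => ?_
    rw [Finset.sum_comm]
    refine Finset.sum_congr rfl fun q _ => ?_
    rw [← Finset.mul_sum, E.sum_volShape, mul_one]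
  simp only [thetaVol, Finset.sum_sub_distrib]
  rw [h, sub_add_cancel, ← Finset.sum_div, ← E.vol_eq_sum, div_self E.vol_pos.ne']

lemma sum_smul_physGrad_eq_zero {c : Fin E.numBasis → ℝ} (hc : ∀ r, ∑ m, c m * E.basis m r = 1)
    (r : Space (n + 1)) : ∑ m, c m • E.physGrad (E.basis m) r = 0 := by
  have h : ∑ m, c m • fderiv ℝ (E.basis m) r = 0 := by
    have h1 : HasFDerivAt (fun r => ∑ m, c m * E.basis m r)
        (∑ m, c m • fderiv ℝ (E.basis m) r) r := by
      refine HasFDerivAt.fun_sum fun m _ => ?_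
      exact (((E.basis_contDiff m).differentiable one_ne_zero r).hasFDerivAt).const_mul (c m)
    have h2 : HasFDerivAt (fun r => ∑ m, c m * E.basis m r) (0 : Space (n + 1) →L[ℝ] ℝ) r := by
      simp only [hc]; exact hasFDerivAt_const _ _
    exact h1.unique h2
  ext i
  have := congrArg (fun L : Space (n + 1) →L[ℝ] ℝ => L ((fderiv ℝ E.map r).inverse (EuclideanSpace.single i 1))) h
  simpa [Element.physGrad] using this

lemma sum_smul_normal_eq_zero :
    ∑ k, ∑ q, (‖E.surfJac k (E.surfPt k q)‖ * E.surfWt k q) • E.normal k q = 0 := by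
  rw [← E.sum_integral_surfJac_eq_zero]
  refine Finset.sum_congr rfl fun k _ => ?_
  rw [E.surf_exact k]
  refine Finset.sum_congr rfl fun q _ => ?_
  have := norm_ne_zero_iff.2 (E.surfJac_ne_zero k q)
  rw [normal, smul_smul]
  congr 1
  field_simp

lemma norm_normal (k : Fin E.numFaces) (q : Fin (E.numSurf k)) : ‖E.normal k q‖ = 1 := by
  have := norm_ne_zero_iff.2 (E.surfJac_ne_zero k q)
  rw [normal, norm_smul, norm_inv, norm_norm, inv_mul_cancel₀ this]

lemma zeta_pos (k : Fin E.numFaces) (q : Fin (E.numSurf k)) : 0 < E.zeta k q :=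
  div_pos (mul_pos (norm_pos_iff.2 (E.surfJac_ne_zero k q)) (E.surfWt_pos k q)) E.vol_pos

lemma sum_zeta_smul_normal_eq_zero : ∑ k, ∑ q, E.zeta k q • E.normal k q = 0 := by
  have h := congrArg (fun x => E.vol⁻¹ • x) E.sum_smul_normal_eq_zero
  simp only [Finset.smul_sum, smul_zero, smul_smul] at h
  rw [← h]
  simp only [zeta, div_eq_inv_mul]

/-- Conservation: the evolution of the element average under one forward-Euler step. -/
lemma IsEulerStep.average_eq {E : DGElement n} {Δt : ℝ} (hΔt : Δt ≠ 0)
    {μ : ∀ k, Fin (E.numSurf k) → ℝ} {Uext : Fin E.numFaces → Space n → State (n + 1)}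
    {W W' : Fin E.numBasis → State (n + 1)} (h : E.IsEulerStep Δt μ Uext W W') :
    E.average W' = E.average W - ∑ k, ∑ q, (Δt * E.zeta k q) •
      laxFriedrichs (μ k q) (E.eval W (E.surfRef k q)) (Uext k (E.surfPt k q))
        (E.normal k q) := by
  -- Combining the tests with the coefficients of the constant `1` kills the volume flux, which is
  -- linear in the gradient, and leaves the boundary fluxes.
  obtain ⟨c, hc⟩ := E.one_mem_span
  set L : ∀ k, Fin (E.numSurf k) → State (n + 1) := fun k q =>
    laxFriedrichs (μ k q) (E.eval W (E.surfRef k q)) (Uext k (E.surfPt k q)) (E.normal k q) with hL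
  have hsum : ∑ v, (E.jac (E.volPt v) * E.volWt v) •
        (Δt⁻¹ • (E.eval W' (E.volPt v) - E.eval W (E.volPt v)))
      + ∑ k, ∑ q, (‖E.surfJac k (E.surfPt k q)‖ * E.surfWt k q) • L k q = 0 := by
    have flux_sum : ∀ (U : State (n + 1)) (r : Space (n + 1)),
        ∑ i, c i • flux U (E.physGrad (E.basis i) r) = 0 := fun U r => by
      let f : Space (n + 1) →ₗ[ℝ] State (n + 1) :=
        { toFun := flux U, map_add' := flux_add_right U, map_smul' := flux_smul_right U }
      have := congrArg f (E.sum_smul_physGrad_eq_zero hc r)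
      rw [map_sum, map_zero] at this
      rw [← this]
      exact Finset.sum_congr rfl fun i _ => (flux_smul_right _ _ _).symm
    have gather : ∀ (w : ℝ) (r : Space (n + 1)) (S : State (n + 1)),
        ∑ i, c i • (w * E.basis i r) • S = w • S := fun w r S => by
      simp only [smul_smul]
      rw [← Finset.sum_smul]
      congr 1
      calc ∑ i, c i * (w * E.basis i r) = w * ∑ i, c i * E.basis i r := by
            rw [Finset.mul_sum]; exact Finset.sum_congr rfl fun i _ => by ring
        _ = w := by rw [hc, mul_one]
    have split : ∀ A B C : Fin E.numBasis → State (n + 1), (∀ i, A i - B i + C i = 0) →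
        ∑ i, c i • A i - ∑ i, c i • B i + ∑ i, c i • C i = 0 := fun A B C h => by
      rw [← Finset.sum_sub_distrib, ← Finset.sum_add_distrib]
      exact Finset.sum_eq_zero fun i _ => by rw [← smul_sub, ← smul_add, h i, smul_zero]
    have h0 := split _ _ _ h
    have e1 : ∑ i, c i • ∑ v, (E.jac (E.volPt v) * E.volWt v * E.basis i (E.volPt v)) •
        (Δt⁻¹ • (E.eval W' (E.volPt v) - E.eval W (E.volPt v))) =
        ∑ v, (E.jac (E.volPt v) * E.volWt v) •
          (Δt⁻¹ • (E.eval W' (E.volPt v) - E.eval W (E.volPt v))) := by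
      simp only [Finset.smul_sum (s := (Finset.univ : Finset (Fin E.numVol)))]
      rw [Finset.sum_comm]
      exact Finset.sum_congr rfl fun v _ => gather _ _ _
    have e2 : ∑ i, c i • ∑ v, (E.jac (E.volPt v) * E.volWt v) •
        flux (E.eval W (E.volPt v)) (E.physGrad (E.basis i) (E.volPt v)) = 0 := by
      simp only [Finset.smul_sum (s := (Finset.univ : Finset (Fin E.numVol)))]
      rw [Finset.sum_comm]
      refine Finset.sum_eq_zero fun v _ => ?_
      simp only [smul_comm (c _) (E.jac (E.volPt v) * E.volWt v)]
      rw [← Finset.smul_sum, flux_sum, smul_zero]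
    have e3 : ∑ i, c i • ∑ k, ∑ q,
        (‖E.surfJac k (E.surfPt k q)‖ * E.surfWt k q * E.basis i (E.surfRef k q)) • L k q =
        ∑ k, ∑ q, (‖E.surfJac k (E.surfPt k q)‖ * E.surfWt k q) • L k q := by
      simp only [Finset.smul_sum]
      rw [Finset.sum_comm]
      refine Finset.sum_congr rfl fun k _ => ?_
      rw [Finset.sum_comm]
      exact Finset.sum_congr rfl fun q _ => gather _ _ _
    rw [e1, e2, e3, sub_zero] at h0
    exact h0
  have e4 : ∑ v, (E.jac (E.volPt v) * E.volWt v) •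
        (Δt⁻¹ • (E.eval W' (E.volPt v) - E.eval W (E.volPt v))) =
      Δt⁻¹ • (E.vol • (E.average W' - E.average W)) := by
    rw [E.average_eq, E.average_eq, ← smul_sub, smul_smul _ E.vol⁻¹,
      mul_inv_cancel₀ E.vol_pos.ne', one_smul, ← Finset.sum_sub_distrib, Finset.smul_sum]
    exact Finset.sum_congr rfl fun v _ => by rw [smul_comm, smul_sub]
  have e5 : ∑ k, ∑ q, (Δt * E.zeta k q) • L k q =
      (Δt * E.vol⁻¹) • ∑ k, ∑ q, (‖E.surfJac k (E.surfPt k q)‖ * E.surfWt k q) • L k q := by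
    simp only [Finset.smul_sum, smul_smul, zeta, div_eq_inv_mul, mul_assoc]
  rw [e4] at hsum
  rw [e5, eq_neg_of_add_eq_zero_right hsum, smul_neg, smul_smul, smul_smul, sub_neg_eq_add]
  have : Δt * E.vol⁻¹ * Δt⁻¹ * E.vol = 1 := by
    have := E.vol_pos.ne'
    field_simp
  rw [this, one_smul]
  abel

end DGElement

/-! ### The entropy and its superlevel sets -/

section Entropy

variable {d : ℕ}

/-- Exponentiating the entropy gives `p ≥ exp (s - s₀) * ρ^(7/5)`; as `p` is `2/5` of the internal
energy, this is where `κ = 5/2 * exp (s - s₀)` comes from. -/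
lemma minEntropy_of_le_entropy {s₀ s : ℝ} {U : State d} (hU : Admissible U)
    (hs : s ≤ entropy s₀ U) : MinEntropy (5 / 2 * Real.exp (s - s₀)) U := by
  obtain ⟨hρ, hp⟩ := hU
  obtain ⟨x, -, hx, -, hxρ, -⟩ := exists_fifth_root_and_speed one_pos hρ
  refine ⟨hρ, x, hx, hxρ, ?_⟩
  have h1 : s - s₀ + 7 * Real.log x ≤ Real.log (pressure U) := by
    rw [entropy, ← hxρ, Real.log_pow, gasGamma] at hs
    push_cast at hs
    linarith
  have h2 : Real.exp (s - s₀) * x ^ 7 ≤ pressure U := by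
    have h := Real.exp_le_exp.2 h1
    rw [Real.exp_log hp, Real.exp_add] at h
    have e : Real.exp (7 * Real.log x) = x ^ 7 := by
      rw [← Real.exp_log (pow_pos hx 7), Real.log_pow]; norm_num
    rwa [e] at h
  rw [pressure_eq] at h2
  rw [← hxρ]
  nlinarith

lemma MinEntropy.admissible_and_le_entropy {s₀ s : ℝ} {U : State d}
    (hU : MinEntropy (5 / 2 * Real.exp (s - s₀)) U) : Admissible U ∧ s ≤ entropy s₀ U := by
  obtain ⟨hρ, x, hx, hxρ, h⟩ := hU
  have h2 : Real.exp (s - s₀) * x ^ 7 ≤ pressure U := by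
    rw [pressure_eq]; rw [← hxρ] at h; nlinarith
  have hpos : 0 < Real.exp (s - s₀) * x ^ 7 := by positivity
  refine ⟨⟨hρ, hpos.trans_le h2⟩, ?_⟩
  have h3 := Real.log_le_log hpos h2
  rw [Real.log_mul (Real.exp_pos _).ne' (by positivity), Real.log_exp, Real.log_pow] at h3
  rw [entropy, ← hxρ, Real.log_pow, gasGamma]
  push_cast at h3 ⊢
  linarith

lemma continuousOn_entropy (s₀ : ℝ) : ContinuousOn (entropy s₀) {U : State d | Admissible U} := by
  have hρ : Continuous (density : State d → ℝ) := continuous_fst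
  have hm : Continuous (momentum : State d → Space d) := continuous_fst.comp continuous_snd
  have hE : Continuous (energy : State d → ℝ) := continuous_snd.comp continuous_snd
  have hu : ContinuousOn (velocity : State d → Space d) {U | Admissible U} :=
    (hρ.continuousOn.inv₀ fun U hU => hU.1.ne').smul hm.continuousOn
  have hp : ContinuousOn (pressure : State d → ℝ) {U | Admissible U} :=
    continuousOn_const.mul (hE.continuousOn.sub
      ((hρ.continuousOn.mul (hu.norm.pow 2)).div_const 2))
  exact ((hp.log fun U hU => hU.2.ne').sub
    (continuousOn_const.mul (hρ.continuousOn.log fun U hU => hU.1.ne'))).add continuousOn_const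

lemma waveSpeed_nonneg (U : State d) : 0 ≤ waveSpeed U :=
  add_nonneg (norm_nonneg _) (Real.sqrt_nonneg _)

end Entropy

/-! ### Convex decomposition of the updated average -/

namespace DGElement

variable {n : ℕ} (E : DGElement n)

lemma continuous_eval (W : Fin E.numBasis → State (n + 1)) : Continuous (E.eval W) :=
  continuous_finsetSum _ fun m _ => (E.basis_contDiff m).continuous.smul continuous_const

lemma isCompact_localStates (W : Fin E.numBasis → State (n + 1))
    {Uext : Fin E.numFaces → Space n → State (n + 1)}
    (hUext : ∀ k, ContinuousOn (Uext k) (E.face k)) : IsCompact (E.localStates W Uext) := by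
  have e : E.localStates W Uext = E.eval W '' E.ref ∪ ⋃ k, Uext k '' E.face k := by
    ext S
    simp only [localStates, Set.mem_union, Set.mem_ofPred_eq, Set.mem_image, Set.mem_iUnion,
      eq_comm (a := S)]
  rw [e]
  exact (E.ref_compact.image (E.continuous_eval W)).union
    (isCompact_iUnion fun k => (E.face_compact k).image_of_continuousOn (hUext k))

lemma mul_waveSpeed_le_lambdaStar (W : Fin E.numBasis → State (n + 1)) (k : Fin E.numFaces)
    (q : Fin (E.numSurf k)) :
    8 / 5 * waveSpeed (E.eval W (E.surfRef k q)) ≤ E.lambdaStar W := by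
  have h1 : (8 / 5 : ℝ) ≤ max √((n + 1 : ℕ) : ℝ) √(2 + gasGamma * (gasGamma - 1)) := by
    apply le_max_of_le_right
    -- For `γ = 7/5`, `2 + γ (γ - 1) = (8/5) ^ 2` exactly, so this entry of the maximum alone
    -- suffices.
    apply Real.le_sqrt_of_sq_le
    rw [gasGamma]; norm_num
  have h2 : waveSpeed (E.eval W (E.surfRef k q)) ≤
      ⨆ j : (k : Fin E.numFaces) × Fin (E.numSurf k), waveSpeed (E.eval W (E.surfRef j.1 j.2)) :=
    le_ciSup (f := fun j : (k : Fin E.numFaces) × Fin (E.numSurf k) =>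
      waveSpeed (E.eval W (E.surfRef j.1 j.2))) (Set.finite_range _).bddAbove ⟨k, q⟩
  exact mul_le_mul h1 h2 (waveSpeed_nonneg _) (by positivity)

lemma minEntropy_average {κ : ℝ} (hκ : 0 < κ) {E : DGElement n}
    {W W' : Fin E.numBasis → State (n + 1)} {Uext : Fin E.numFaces → Space n → State (n + 1)}
    (hW : ∀ r ∈ E.ref, MinEntropy κ (E.eval W r))
    (hUext : ∀ k, ∀ g ∈ E.face k, MinEntropy κ (Uext k g))
    {Δt lam : ℝ} (hΔt : 0 < Δt) {μ : ∀ k, Fin (E.numSurf k) → ℝ}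
    (hμ_int : ∀ k q, waveSpeed (E.eval W (E.surfRef k q)) ≤ μ k q)
    (hμ_ext : ∀ k q, waveSpeed (Uext k (E.surfPt k q)) ≤ μ k q)
    (hμ_lam : ∀ k q, μ k q ≤ lam)
    (hlam : ∀ k q, 8 / 5 * waveSpeed (E.eval W (E.surfRef k q)) ≤ lam)
    (hstep : E.IsEulerStep Δt μ Uext W W') {θ : ∀ k, Fin (E.numSurf k) → ℝ}
    (hθ_vol : ∀ v, 0 ≤ E.thetaVol θ v)
    (hCFL : ∀ k q, Δt * lam ≤ 1 / 2 * (θ k q / E.zeta k q)) :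
    MinEntropy κ (E.average W') := by
  set ι := (k : Fin E.numFaces) × Fin (E.numSurf k) with hι
  set P : ι → State (n + 1) := fun j => E.eval W (E.surfRef j.1 j.2) with hPdef
  set Q : ι → State (n + 1) := fun j => Uext j.1 (E.surfPt j.1 j.2) with hQdef
  set a : ι → Space (n + 1) := fun j => E.normal j.1 j.2 with hadef
  set ζ : ι → ℝ := fun j => E.zeta j.1 j.2 with hζdef
  set m : ι → ℝ := fun j => μ j.1 j.2 with hmdef
  set ϑ : ι → ℝ := fun j => θ j.1 j.2 with hϑdef
  have hP : ∀ j, MinEntropy κ (P j) := fun j => hW _ (E.facePar_mem_ref (E.surfPt_mem j.1 j.2))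
  have hQ : ∀ j, MinEntropy κ (Q j) := fun j => hUext _ _ (E.surfPt_mem j.1 j.2)
  have hζ : ∀ j, 0 < ζ j := fun j => E.zeta_pos j.1 j.2
  -- Positivity of `lam` is only available when there is a surface point; without one, all surface
  -- sums are empty.
  have hlam0 : ι → 0 < lam := fun j => by
    have h1 := (hP j).soundSpeed_pos hκ
    have h2 := hlam j.1 j.2
    rw [waveSpeed] at h2
    linarith [norm_nonneg (velocity (E.eval W (E.surfRef j.1 j.2)))]
  set VP : ι → State (n + 1) := fun j =>
    (2 * lam)⁻¹ • ((m j • Q j - flux (Q j) (a j)) + ((2 * lam - m j) • P j + flux (P j) (a j)))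
    with hVP
  set VB : State (n + 1) := (lam * ∑ j, ζ j)⁻¹ • ∑ j, ζ j • (lam • P j - flux (P j) (a j)) with hVB
  have hVP' : ∀ j, MinEntropy κ (VP j) := fun j =>
    minEntropy_pair hκ (hP j) (hQ j) (E.norm_normal j.1 j.2) (hμ_int j.1 j.2) (hμ_ext j.1 j.2)
      (hμ_lam j.1 j.2) (hlam j.1 j.2)
  have hZ : ι → 0 < ∑ j, ζ j := fun j =>
    Finset.sum_pos (fun j _ => hζ j) ⟨j, Finset.mem_univ j⟩
  have hVB' : ι → MinEntropy κ VB := fun j =>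
    minEntropy_closed_surface hκ hP (fun j => (hζ j).le) (hZ j)
      (fun j => E.norm_normal j.1 j.2)
      (by rw [Fintype.sum_sigma]; exact E.sum_zeta_smul_normal_eq_zero) (fun j => hlam j.1 j.2)
  have hVBsum : ∑ j, (Δt * lam * ζ j) • VB = ∑ j, (Δt * ζ j) • (lam • P j - flux (P j) (a j)) := by
    rcases isEmpty_or_nonempty ι with h | ⟨⟨j₀⟩⟩
    · simp
    · have h1 := hlam0 j₀
      have h2 := hZ j₀
      rw [← Finset.sum_smul, ← Finset.mul_sum, hVB, smul_smul]
      have : Δt * lam * (∑ j, ζ j) * (lam * ∑ j, ζ j)⁻¹ = Δt := by field_simp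
      rw [this, Finset.smul_sum]
      exact Finset.sum_congr rfl fun j _ => by rw [smul_smul]
  -- The pair state contains `+flux P / 2`, so a full `-flux P` is left over for the closed-surface
  -- state. Each of the two borrows `Δt * lam * ζ` of the interior trace, which accounts for the
  -- factor `1/2` in the CFL condition.
  have hpt : ∀ j, ϑ j • P j - (Δt * ζ j) • laxFriedrichs (m j) (P j) (Q j) (a j) =
      (ϑ j - 2 * (Δt * lam * ζ j)) • P j + (Δt * lam * ζ j) • VP j
        + (Δt * ζ j) • (lam • P j - flux (P j) (a j)) := fun j => by
    have h1 : Δt * lam * ζ j * (2 * lam)⁻¹ = Δt * ζ j / 2 := by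
      have := (hlam0 j).ne'
      field_simp
    rw [hVP]
    simp only [smul_smul, h1, laxFriedrichs]
    module
  have hsum : E.average W' = ∑ v, E.thetaVol θ v • E.eval W (E.volPt v)
      + (∑ j, (ϑ j - 2 * (Δt * lam * ζ j)) • P j
        + (∑ j, (Δt * lam * ζ j) • VP j + ∑ j, (Δt * lam * ζ j) • VB)) := by
    rw [hstep.average_eq hΔt.ne', E.average_eq_sum_thetaVol W θ, hVBsum, add_sub_assoc]
    congr 1
    rw [← Finset.sum_add_distrib, ← Finset.sum_add_distrib,
      ← Fintype.sum_sigma' (fun k q => θ k q • E.eval W (E.surfRef k q)),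
      ← Fintype.sum_sigma' (fun k q => (Δt * E.zeta k q) •
        laxFriedrichs (μ k q) (E.eval W (E.surfRef k q)) (Uext k (E.surfPt k q)) (E.normal k q)),
      ← Finset.sum_sub_distrib]
    exact Finset.sum_congr rfl fun j _ => (hpt j).trans (add_assoc _ _ _)
  let w : Fin E.numVol ⊕ ι ⊕ ι ⊕ ι → ℝ :=
    Sum.elim (E.thetaVol θ) (Sum.elim (fun j => ϑ j - 2 * (Δt * lam * ζ j))
      (Sum.elim (fun j => Δt * lam * ζ j) fun j => Δt * lam * ζ j))
  let S : Fin E.numVol ⊕ ι ⊕ ι ⊕ ι → State (n + 1) :=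
    Sum.elim (fun v => E.eval W (E.volPt v)) (Sum.elim P (Sum.elim VP fun _ => VB))
  have hwS : E.average W' = ∑ i, w i • S i := by
    simp only [Fintype.sum_sum_type, w, S, Sum.elim_inl, Sum.elim_inr]
    exact hsum
  rw [hwS]
  refine (convex_minEntropy hκ).sum_mem (t := Finset.univ) ?_ ?_ ?_
  · rintro (v | j | j | j) -
    · exact hθ_vol v
    · have h := hCFL j.1 j.2
      rw [← mul_div_assoc, le_div_iff₀ (hζ j)] at h
      simp only [w, Sum.elim_inl, Sum.elim_inr]
      linarith
    all_goals
      have h1 := hlam0 j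
      have h2 := hζ j
      simp only [w, Sum.elim_inl, Sum.elim_inr]
      positivity
  · have h := E.sum_thetaVol θ
    rw [← Fintype.sum_sigma' (fun k q => θ k q)] at h
    simp only [Fintype.sum_sum_type, w, Sum.elim_inl, Sum.elim_inr, Finset.sum_sub_distrib,
      ← Finset.mul_sum]
    linarith
  · rintro (v | j | j | j) -
    · exact hW _ (E.volPt_mem v)
    · exact hP j
    · exact hVP' j
    · exact hVB' j

end DGElement

end EBDG

end

open EBDG
theorem lemma5 {n : ℕ} (s₀ : ℝ) (E : DGElement n)
    (W W' : Fin E.numBasis → State (n + 1))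
    (Uext : Fin E.numFaces → Space n → State (n + 1))
    (hW : ∀ r ∈ E.ref, Admissible (E.eval W r))
    (hUext : ∀ k, ∀ g ∈ E.face k, Admissible (Uext k g))
    (hUext_cont : ∀ k, ContinuousOn (Uext k) (E.face k))
    (Δt lam : ℝ) (hΔt : 0 < Δt)
    (μ : ∀ k, Fin (E.numSurf k) → ℝ)
    (hμ_int : ∀ k q, waveSpeed (E.eval W (E.surfRef k q)) ≤ μ k q)
    (hμ_ext : ∀ k q, waveSpeed (Uext k (E.surfPt k q)) ≤ μ k q)
    (hμ_lam : ∀ k q, μ k q ≤ lam)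
    (hlam_star : E.lambdaStar W ≤ lam)
    (hstep : E.IsEulerStep Δt μ Uext W W')
    (θ : ∀ k, Fin (E.numSurf k) → ℝ)
    (hθ_vol : ∀ v, 0 ≤ E.thetaVol θ v)
    (hθ_surf : ∀ k q, 0 < θ k q)
    (hCFL : ∀ k q, Δt * lam ≤ 1 / 2 * (θ k q / E.zeta k q)) :
    Admissible (E.average W') ∧
      ∃ sMin : ℝ, IsLeast (entropy s₀ '' E.localStates W Uext) sMin ∧
        sMin ≤ entropy s₀ (E.average W') := by
  have hadm : ∀ S ∈ E.localStates W Uext, Admissible S := by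
    rintro S (⟨r, hr, rfl⟩ | ⟨k, g, hg, rfl⟩)
    · exact hW r hr
    · exact hUext k g hg
  obtain ⟨r₀, hr₀⟩ := E.ref_nonempty
  obtain ⟨sMin, hs⟩ := ((E.isCompact_localStates W hUext_cont).image_of_continuousOn
    ((continuousOn_entropy s₀).mono hadm)).exists_isLeast
      ⟨_, Set.mem_image_of_mem _ (Or.inl ⟨r₀, hr₀, rfl⟩)⟩
  -- All local states lie in the convex set cut out at the level of their minimum entropy, so
  -- membership of the average gives positivity and the entropy bound at once.
  have hmin : ∀ S ∈ E.localStates W Uext, MinEntropy (5 / 2 * Real.exp (sMin - s₀)) S :=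
    fun S hS => minEntropy_of_le_entropy (hadm S hS) (hs.2 (Set.mem_image_of_mem _ hS))
  have key := DGElement.minEntropy_average (by positivity)
    (fun r hr => hmin _ (Or.inl ⟨r, hr, rfl⟩)) (fun k g hg => hmin _ (Or.inr ⟨k, g, hg, rfl⟩))
    hΔt hμ_int hμ_ext hμ_lam
    (fun k q => (E.mul_waveSpeed_le_lambdaStar W k q).trans hlam_star) hstep hθ_vol hCFL
  obtain ⟨h1, h2⟩ := key.admissible_and_le_entropy
  exact ⟨h1, sMin, hs, h2⟩
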